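/- **Setting.** A sequence $(p_n)_{n\ge 0}$ of polynomials in $\mathbb C[x]$ is called a sequence of orthogonal polynomials if $\deg p_n=n$ for every $n$ and there is a linear functional $u:\mathbb C[x]\to\mathbb C$ with $u(p_mp_n)=0$ for $m\ne n$ and $u(p_n^2)\neq 0$ for all $n$. For $0<q<1$ the Askey-Wilson operator $\mathcal D_q:\mathbb C[x]\to\mathbb C[x]$ is the linear operator $$(\mathcal D_qf)(x)=\frac{f(x_+)-f(x_-)}{x_+-x_-},\qquad x=\tfrac12(z+z^{-1}),\quad x_\pm=\tfrac12\bigl(q^{\pm1/2}z+q^{\mp1/2}z^{-1}\bigr),$$ and $\mathcal D_q^k$ is its $k$-th iterate. For $a,b,c,d\in\mathbb C$ with $a\ne0$ the Askey-Wilson polynomials are $$p_n(x;a,b,c,d\,|\,q)=\frac{(ab,ac,ad;q)_n}{a^{n}}\;{}_4\phi_3\!\left(\begin{matrix}q^{-n},\,abcd\,q^{n-1},\,az,\,a/z\\ ab,\,ac,\,ad\end{matrix};q,q\right),\qquad x=\tfrac12(z+z^{-1}),$$ where the quotients $(ab,ac,ad;q)_n/(ab,ac,ad;q)_m$ are read as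 $(abq^m,acq^m,adq^m;q)_{n-m}$. All limits of polynomials are limits of each coefficient. A limiting case of $\mathcal D_q$ is a linear operator $\mathcal D$ on $\mathbb C[y]$ for which there are sequences $q_j\in(0,1)$, $\alpha_j\in\mathbb C\setminus\{0\}$, $\beta_j,\kappa_j\in\mathbb C$ such that, for every polynomial $f$, $\kappa_j\,\mathcal D^{(j)}f\to\mathcal Df$ as $j\to\infty$, where $\mathcal D^{(j)}$ is $\mathcal D_{q_j}$ read in the variable $y=\alpha_jx+\beta_j$. **Theorem.** Let $k\ge 1$ be an integer and let $(p_n)_{n\ge0}$ be a sequence of orthogonal polynomials. 1. Let $0<q<1$. If $(\mathcal D_q^kp_{n+k})_{n\ge0}$ is a sequence of orthogonal polynomials, then the $p_n$ are multiples of Askey-Wilson polynomials, or special or limiting cases of them: there are sequences of parameters $a_j,b_j,c_j,d_j\in\mathbb C$, $a_j\ne0$, independent of $n$, and nonzero constants $r_{n,j}$ such that, for every $n$, $$p_n(x)=\lim_{j\to\infty}r_{n,j}\;p_n(x;a_j,b_j,c_j,d_j\,|\,q).$$ 2. Let $\mathcal D$ be a limiting case of $\mathcal D_q$, with $q_j,\alpha_j,\beta_j$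 as above. If $(\mathcal D^kp_{n+k})_{n\ge0}$ is a sequence of orthogonal polynomials, then the $p_n$ are limiting cases of multiples of Askey-Wilson polynomials along the same limit: there are $a_j,b_j,c_j,d_j\in\mathbb C$, $a_j\ne0$, independent of $n$, and nonzero constants $r_{n,j}$ such that, for every $n$, $$p_n(y)=\lim_{j\to\infty}r_{n,j}\;p_n\!\left(\frac{y-\beta_j}{\alpha_j};a_j,b_j,c_j,d_j\,\Big|\,q_j\right).$$ The case $k=1$ is the corresponding statement for $(\mathcal D_qp_{n+1})_{n\ge0}$. -/

import Mathlib

open Polynomial Filter Topology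

noncomputable section

/-- An orthogonal polynomial sequence: `p n` has exact degree `n`, and the `p n` are orthogonal,
with nonzero squared norms, for some linear functional `u` on polynomials. -/
def IsOPS (p : ℕ → ℂ[X]) : Prop :=
  (∀ n, (p n).degree = n) ∧
    ∃ u : ℂ[X] →ₗ[ℂ] ℂ, (∀ m n, m ≠ n → u (p m * p n) = 0) ∧ ∀ n, u (p n * p n) ≠ 0

/-- `α = (q^{1/2} + q^{-1/2}) / 2`. -/
def awAlpha (q : ℝ) : ℂ := (((Real.sqrt q + (Real.sqrt q)⁻¹) / 2 : ℝ) : ℂ)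

/-- The image of `X ^ n` under the Askey-Wilson operator, that is `(u ^ n - v ^ n) / (u - v)` where
`u, v = (q^{±1/2} z + (q^{±1/2} z)⁻¹) / 2` and `X = (z + z⁻¹) / 2`; here `u + v = 2 α X` and
`u v = X ^ 2 + α ^ 2 - 1`. -/
def awMonomial (q : ℝ) : ℕ → ℂ[X]
  | 0 => 0
  | 1 => 1
  | n + 2 => C (2 * awAlpha q) * X * awMonomial q (n + 1)
      - (X ^ 2 + C (awAlpha q ^ 2 - 1)) * awMonomial q n

/-- The Askey-Wilson divided difference operator `𝒟_q` on polynomials, characterised by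
`awOp_spec` below. -/
def awOp (q : ℝ) : Module.End ℂ ℂ[X] :=
  Polynomial.lsum fun n => (LinearMap.id : ℂ →ₗ[ℂ] ℂ).smulRight (awMonomial q n)

/-- The lattice value `(z + 1 / z) / 2`. -/
def joukowski (z : ℂ) : ℂ := (z + z⁻¹) / 2

theorem awMonomial_spec (q : ℝ) (hq : 0 < q) (z : ℂ) (hz : z ≠ 0) (n : ℕ) :
    (awMonomial q n).eval (joukowski z) *
        (joukowski (Real.sqrt q * z) - joukowski ((Real.sqrt q : ℂ)⁻¹ * z)) =
      joukowski (Real.sqrt q * z) ^ n - joukowski ((Real.sqrt q : ℂ)⁻¹ * z) ^ n := by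
  have hs : (Real.sqrt q : ℂ) ≠ 0 := by
    exact_mod_cast (Real.sqrt_pos.mpr hq).ne'
  set s : ℂ := (Real.sqrt q : ℂ) with hsdef
  have hα : awAlpha q = (s + s⁻¹) / 2 := by simp [awAlpha, hsdef]
  have hsum : 2 * awAlpha q * joukowski z = joukowski (s * z) + joukowski (s⁻¹ * z) := by
    rw [hα]; unfold joukowski; field_simp; ring
  have hprod : joukowski z ^ 2 + (awAlpha q ^ 2 - 1) =
      joukowski (s * z) * joukowski (s⁻¹ * z) := by
    rw [hα]; unfold joukowski; field_simp; ring
  induction n using Nat.twoStepInduction with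
  | zero => simp [awMonomial]
  | one => simp [awMonomial]
  | more n ih0 ih1 =>
    simp only [awMonomial, eval_sub, eval_mul, eval_add, eval_pow, eval_X, eval_C]
    rw [hsum, hprod, sub_mul, mul_assoc, ih1, mul_assoc, ih0]
    ring

/-- `(𝒟_q f)(x) = (f(x₊) - f(x₋)) / (x₊ - x₋)`, where `x = (z + 1/z)/2` and `x₊, x₋` are the values
of the same expression at `q^{1/2} z` and `q^{-1/2} z`. -/
theorem awOp_spec (q : ℝ) (hq : 0 < q) (f : ℂ[X]) (z : ℂ) (hz : z ≠ 0) :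
    (awOp q f).eval (joukowski z) *
        (joukowski (Real.sqrt q * z) - joukowski ((Real.sqrt q : ℂ)⁻¹ * z)) =
      f.eval (joukowski (Real.sqrt q * z)) - f.eval (joukowski ((Real.sqrt q : ℂ)⁻¹ * z)) := by
  induction f using Polynomial.induction_on' with
  | add f g hf hg =>
    rw [map_add, eval_add, add_mul, hf, hg, eval_add, eval_add]; ring
  | monomial n a =>
    have h : awOp q (monomial n a) = a • awMonomial q n := by simp [awOp]
    rw [h, eval_smul, smul_eq_mul, mul_assoc, awMonomial_spec q hq z hz, eval_monomial,
      eval_monomial]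
    ring

/-- The `q`-shifted factorial `(a; q)_n = ∏_{i < n} (1 - a q^i)`. -/
def qPoch (a q : ℂ) (n : ℕ) : ℂ := ∏ i ∈ Finset.range n, (1 - a * q ^ i)

/-- The Askey-Wilson polynomial for `a ≠ 0`,
`(ab, ac, ad; q)_n a⁻ⁿ ₄φ₃(q⁻ⁿ, abcd qⁿ⁻¹, a z, a / z; ab, ac, ad; q, q)` with `x = (z + 1/z)/2`.
The quotients `(ab, ac, ad; q)_n / (ab, ac, ad; q)_k` are written as
`(ab qᵏ, ac qᵏ, ad qᵏ; q)_{n-k}`, and `(az, a/z; q)_k = ∏_{i < k} (1 - 2 a x qⁱ + a² q²ⁱ)`. -/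
def awPoly (q a b c d : ℂ) (n : ℕ) : ℂ[X] :=
  C (a ^ n)⁻¹ * ∑ k ∈ Finset.range (n + 1),
    C (qPoch (q ^ n)⁻¹ q k * qPoch (a * b * c * d * q ^ n / q) q k / qPoch q q k * q ^ k *
        (qPoch (a * b * q ^ k) q (n - k) * qPoch (a * c * q ^ k) q (n - k) *
          qPoch (a * d * q ^ k) q (n - k))) *
      ∏ i ∈ Finset.range k, (1 - C (2 * a * q ^ i) * X + C (a ^ 2 * q ^ (2 * i)))

/-- Coefficientwise convergence of a sequence of polynomials. -/
def CoeffTendsto (f : ℕ → ℂ[X]) (g : ℂ[X]) : Prop :=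
  ∀ i, Tendsto (fun j => (f j).coeff i) atTop (𝓝 (g.coeff i))

/-- `f` read in the new variable `y = α x + β`: the polynomial `y ↦ f ((y - β) / α)`. -/
def affineChange (α β : ℂ) (f : ℂ[X]) : ℂ[X] := f.comp (C α⁻¹ * (X - C β))

/-- `𝒟_q` read in the variable `y = α x + β`: pass from `y` back to `x`, apply `𝒟_q`, and return
to `y`. -/
def awOpAffine (q : ℝ) (α β : ℂ) (f : ℂ[X]) : ℂ[X] :=
  affineChange α β (awOp q (f.comp (C α * X + C β)))

/-- `D` is the limiting case of the Askey-Wilson operators `𝒟_{q_j}`, `0 < q_j < 1`, along the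
variables `y = α_j x + β_j`: after normalisation by constants `κ_j`, the operators `𝒟_{q_j}` read
in these variables converge to `D` on every polynomial. -/
def IsLimitingAWOp (q : ℕ → ℝ) (α β : ℕ → ℂ) (D : Module.End ℂ ℂ[X]) : Prop :=
  (∀ j, 0 < q j ∧ q j < 1) ∧ (∀ j, α j ≠ 0) ∧
    ∃ κ : ℕ → ℂ, ∀ f, CoeffTendsto (fun j => C (κ j) * awOpAffine (q j) (α j) (β j) f) (D f)

/-- The `p n` are multiples of Askey-Wilson polynomials in base `q`, or special or limiting cases
of them: suitable nonzero multiples of Askey-Wilson polynomials converge to `p n` as the parameters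
run through a sequence that does not depend on `n`. (Constant sequences give the Askey-Wilson
polynomials themselves; parameters tending to zero or to infinity give special and limiting
cases.) -/
def IsAskeyWilsonOrLimit (q : ℝ) (p : ℕ → ℂ[X]) : Prop :=
  ∃ a b c d : ℕ → ℂ, (∀ j, a j ≠ 0) ∧ ∃ r : ℕ → ℕ → ℂ, (∀ n j, r n j ≠ 0) ∧
    ∀ n, CoeffTendsto (fun j => C (r n j) * awPoly q (a j) (b j) (c j) (d j) n) (p n)

/-- The same for the limiting process given by the bases `q_j` and the variables
`y = α_j x + β_j`. -/
def IsAskeyWilsonLimitAlong (q : ℕ → ℝ) (α β : ℕ → ℂ) (p : ℕ → ℂ[X]) : Prop :=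
  ∃ a b c d : ℕ → ℂ, (∀ j, a j ≠ 0) ∧ ∃ r : ℕ → ℕ → ℂ, (∀ n j, r n j ≠ 0) ∧
    ∀ n, CoeffTendsto (fun j => C (r n j) *
      affineChange (α j) (β j) (awPoly (q j) (a j) (b j) (c j) (d j) n)) (p n)

end

/-! Everything rests on one class of operators: `f ↦ (f(U) - f(V)) / (U - V)`, where `U, V` are the
roots `Y` of the conic `X² + Y² - 2αXY - 2δ(X + Y) + ε = 0`. The class contains `𝒟_q` and is stable
under affine changes of variable and, after normalisation, under limits, so one algebraic argument
serves all cases.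

Write `Q_n = D^k p_{n+k}`, orthogonal for `v`. The three-term recurrences and the commutation of `X`
with `D^k` give a Pearson equation `v(φ Df + ψ D(Xf)) = 0` with `deg φ ≤ 2` and `ψ = Q_1`
(`exists_pearson`). Summation by parts then gives `v(g Mf) = w(Df Dg)` for `M = φD² + ψDXD`; hence
`M` is symmetric and the `Q_n` are its eigenfunctions. There is an operator `L` of the same shape
with `D^k L = (M + c) D^k` (`exists_lift_pow`), so `p_n` is an eigenfunction of `L` up to a
remainder of degree less than `k`. An Askey-Wilson algebra relation between `L` and `X` forces the
remainder to vanish and also reaches the `p_n` with `n < k` (`secondOrder_mem_orthoLT`). The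
eigenvalues are pairwise distinct, by `eigenFactor_ne_zero` and `eigenValue_sub`.

Conversely, the coefficients of such an operator for `𝒟_q` form a quartic in `z` whose factorisation
yields generic parameters `a, b, c, d`; the Askey-Wilson polynomials are its eigenfunctions
(`secondOrder_awPoly`). Where the quartic degenerates, a coefficient is perturbed. Since the
eigenvalues are distinct, the degree `n` eigenfunction is a multiple of `∏_{m<n} (L - λ_m) X^n`,
which is continuous in `L`; this carries the identification to the limit. -/

/-- Induction principle for polynomials along multiplication by `X`. -/
theorem poly_induction_X {P : ℂ[X] → Prop} (h1 : P 1) (hadd : ∀ f g, P f → P g → P (f + g))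
    (hC : ∀ a f, P f → P (C a * f)) (hX : ∀ f, P f → P (X * f)) (f : ℂ[X]) : P f := by
  have hpow : ∀ n : ℕ, P (X ^ n) := by
    intro n
    induction n with
    | zero => simpa using h1
    | succ n ih => rw [pow_succ']; exact hX _ ih
  induction f using Polynomial.induction_on' with
  | add f g hf hg => exact hadd f g hf hg
  | monomial n a => rw [← C_mul_X_pow_eq_monomial]; exact hC _ _ (hpow n)

theorem map_C_mul (D : Module.End ℂ ℂ[X]) (a : ℂ) (f : ℂ[X]) : D (C a * f) = C a * D f := by
  rw [← smul_eq_C_mul, ← smul_eq_C_mul, map_smul]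

theorem map_C_mul' (D : ℂ[X] →ₗ[ℂ] ℂ) (a : ℂ) (f : ℂ[X]) : D (C a * f) = a * D f := by
  rw [← smul_eq_C_mul, map_smul, smul_eq_mul]

/-! ### Divided differences on a symmetric conic: commutation and product rules. -/

/-- Divided difference operators `f ↦ (f(U) - f(V)) / (U - V)`, where `U + V = 2 α X + 2 δ` and
`U V = X ^ 2 - 2 δ X + ε`. -/
structure IsDividedDifference (α δ ε : ℂ) (D : Module.End ℂ ℂ[X]) : Prop where
  map_one : D 1 = 0
  map_X : D X = 1
  rel : ∀ f, D (X ^ 2 * f) = (2 * C α * X + 2 * C δ) * D (X * f)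
    - (X ^ 2 - 2 * C δ * X + C ε) * D f

namespace IsDividedDifference

variable {α δ ε : ℂ} {D : Module.End ℂ ℂ[X]}

/-- The conic is symmetric in `X` and `Y`, so each of `U, V` has `X` among its own neighbours, and
the words `DDX` and `DXDX` reduce to words ending in `D`. Both reductions propagate from `f` to `X *
f` through `rel`. -/
theorem sq_mul_comp (h : IsDividedDifference α δ ε D) (f : ℂ[X]) : D (D (X * f)) =
    2 * C α * D (X * D f) - X * D (D f) + 2 * C δ * D (D f) := by
  induction f using poly_induction_X with
  | h1 => simp [h.map_one, h.map_X]
  | hadd f g hf hg => simp only [mul_add, map_add, hf, hg]; ring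
  | hC a f hf =>
    have e : ∀ g : ℂ[X], X * (C a * g) = C a * (X * g) := fun g => by ring
    simp only [e, map_C_mul, hf]; ring
  | hX f hf =>
    have h1 := congrArg D (h.rel f)
    have h2 := h.rel (D f)
    have e1 : (2 * C α * X + 2 * C δ) * D (X * f) - (X ^ 2 - 2 * C δ * X + C ε) * D f =
      C (2 * α) * (X * D (X * f)) + C (2 * δ) * D (X * f) - X ^ 2 * D f + C (2 * δ) * (X * D f)
        - C ε * D f := by
      simp only [C_mul, map_ofNat]; ring
    rw [e1] at h1
    simp only [map_sub, map_add, map_C_mul] at h1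
    simp only [C_mul, map_ofNat] at h1
    rw [show X * (X * f) = X ^ 2 * f by ring]
    linear_combination h1 - h2 + X * hf

theorem mul_mul_comp (h : IsDividedDifference α δ ε D) (f : ℂ[X]) : D (X * D (X * f)) =
    f - X * D (X * D f) + 2 * C α * D (X ^ 2 * D f) + 2 * C δ * D (X * D f) := by
  induction f using poly_induction_X with
  | h1 => simp [h.map_one, h.map_X]
  | hadd f g hf hg => simp only [mul_add, map_add, hf, hg]; ring
  | hC a f hf =>
    have e : ∀ r g : ℂ[X], r * (C a * g) = C a * (r * g) := fun r g => by ring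
    simp only [e, map_C_mul, hf]; ring
  | hX f hf =>
    have h1 := congrArg (fun g => D (X * g)) (h.rel f)
    have h2 := h.rel (X * D f)
    have e1 : X * ((2 * C α * X + 2 * C δ) * D (X * f) - (X ^ 2 - 2 * C δ * X + C ε) * D f) =
      C (2 * α) * (X ^ 2 * D (X * f)) + C (2 * δ) * (X * D (X * f)) - X ^ 2 * (X * D f)
        + C (2 * δ) * (X ^ 2 * D f) - C ε * (X * D f) := by
      simp only [C_mul, map_ofNat]; ring
    simp only [e1] at h1
    simp only [map_sub, map_add, map_C_mul] at h1
    simp only [C_mul, map_ofNat] at h1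
    rw [show X * (X * f) = X ^ 2 * f by ring]
    rw [show X * (X * D f) = X ^ 2 * D f by ring] at h2
    linear_combination h1 - h2 + X * hf

/-- The values `f(U) = D(Xf) - V Df` and `f(V) = D(Xf) - U Df` are encoded by the pair `Df, D(Xf)`.
Multiplying them and eliminating `U, V` through `U + V` and `U V` gives both formulas. -/
theorem leibniz (h : IsDividedDifference α δ ε D) (f : ℂ[X]) : ∀ g,
    D (f * g) = D f * D (X * g) + D (X * f) * D g - (2 * C α * X + 2 * C δ) * (D f * D g) ∧
    D (X * (f * g)) = D (X * f) * D (X * g) - (X ^ 2 - 2 * C δ * X + C ε) * (D f * D g) := by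
  induction f using poly_induction_X with
  | h1 => intro g; simp [h.map_one, h.map_X]
  | hadd f g hf hg =>
    intro k
    have a := hf k
    have b := hg k
    simp only [mul_add, add_mul, map_add]
    constructor
    · linear_combination a.1 + b.1
    · linear_combination a.2 + b.2
  | hC a f hf =>
    intro k
    have b := hf k
    rw [show C a * f * k = C a * (f * k) by ring,
      show X * (C a * (f * k)) = C a * (X * (f * k)) by ring,
      show X * (C a * f) = C a * (X * f) by ring]
    simp only [map_C_mul]
    constructor
    · linear_combination C a * b.1
    · linear_combination C a * b.2
  | hX f hf =>
    intro k
    have b := hf k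
    have r1 := h.rel f
    have r2 := h.rel (f * k)
    rw [show X * f * k = X * (f * k) by ring, show X * (X * (f * k)) = X ^ 2 * (f * k) by ring,
      show X * (X * f) = X ^ 2 * f by ring]
    constructor
    · linear_combination b.2 - D k * r1
    · linear_combination r2 + (2 * C α * X + 2 * C δ) * b.2
        - (X ^ 2 - 2 * C δ * X + C ε) * b.1 - D (X * k) * r1

/-- The factor `D(Xg) - (αX + δ) Dg` is the average `(g(U) + g(V)) / 2`. After multiplication by
`Df` and application of `D`, the part not depending on the product `Df * Dg` alone is `g` times a
second derivative of `f`: this is summation by parts. -/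
theorem map_leibniz_left (h : IsDividedDifference α δ ε D) (f g : ℂ[X]) :
    D (D f * (D (X * g) - (C α * X + C δ) * D g)) = g * D (D f) + C α * D (X * (D f * D g))
      + (C δ - X) * D (D f * D g) ∧
    D (X * (D f * (D (X * g) - (C α * X + C δ) * D g))) = g * D (X * D f)
      + (C α * (2 * C α * X + 2 * C δ) + C δ - X) * D (X * (D f * D g))
      - C α * (X ^ 2 - 2 * C δ * X + C ε) * D (D f * D g) := by
  have a := h.leibniz (D f) (D (X * g))
  have b := h.leibniz (D f) (D g)
  have c := h.rel (D f * D g)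
  have d := h.sq_mul_comp g
  have e := h.mul_mul_comp g
  have k := h.rel (D g)
  have e1 : D f * (D (X * g) - (C α * X + C δ) * D g) =
    D f * D (X * g) - C α * (X * (D f * D g)) - C δ * (D f * D g) := by ring
  have e2 : X * (D f * (D (X * g) - (C α * X + C δ) * D g)) =
    X * (D f * D (X * g)) - C α * (X ^ 2 * (D f * D g)) - C δ * (X * (D f * D g)) := by ring
  rw [e2, e1]
  simp only [map_sub, map_C_mul, c, a.1, a.2, b.1, b.2, d, e, k]
  constructor <;> ring

/-- Iterating `sq_mul_comp` moves `X` past `D^k`; the coefficients inherit the recurrence of the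
`q`-numbers. -/
theorem pow_comp_mul (h : IsDividedDifference α δ ε D) (γ : ℕ → ℂ) (h0 : γ 0 = 0) (h1 : γ 1 = 1)
    (h2 : ∀ n, γ (n + 2) = 2 * α * γ (n + 1) - γ n) (k : ℕ) : ∃ e : ℂ, ∀ f,
    (D ^ (k + 1)) (X * f) = C (γ (k + 1)) * D (X * (D ^ k) f) - C (γ k) * (X * (D ^ (k + 1)) f)
      + C e * (D ^ (k + 1)) f := by
  induction k with
  | zero => exact ⟨0, fun f => by simp [h0, h1]⟩
  | succ k ih =>
    obtain ⟨e, he⟩ := ih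
    refine ⟨e + 2 * δ * γ (k + 1), fun f => ?_⟩
    have hs : ∀ (n : ℕ) g, (D ^ (n + 1)) g = D ((D ^ n) g) := fun n g => by
      rw [pow_succ']; rfl
    rw [hs (k + 1) (X * f), he f, hs (k + 1) f]
    simp only [map_add, map_sub, map_C_mul]
    rw [h.sq_mul_comp ((D ^ k) f), hs k f, h2 k]
    simp only [C_sub, C_mul, map_ofNat]
    ring

end IsDividedDifference

/-! ### Second order operators: algebra relation, lifting and symmetry. -/

/-- The second order operator `φ D² + ψ D X D`. -/
noncomputable def secondOrder (D : Module.End ℂ ℂ[X]) (φ ψ : ℂ[X]) : Module.End ℂ ℂ[X] :=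
  LinearMap.mulLeft ℂ φ ∘ₗ D ∘ₗ D +
    LinearMap.mulLeft ℂ ψ ∘ₗ D ∘ₗ LinearMap.mulLeft ℂ X ∘ₗ D

theorem secondOrder_apply (D : Module.End ℂ ℂ[X]) (φ ψ f : ℂ[X]) :
    secondOrder D φ ψ f = φ * D (D f) + ψ * D (X * D f) := rfl

/-- A polynomial of degree at most two with given coefficients. -/
noncomputable def quad (a0 a1 a2 : ℂ) : ℂ[X] := C a0 + C a1 * X + C a2 * X ^ 2

namespace IsDividedDifference

variable {α δ ε : ℂ} {D : Module.End ℂ ℂ[X]}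

/-- A defining relation of the Askey-Wilson algebra. The left side, quadratic in `X` and linear in
the operator, collapses to multiplication by a polynomial, of degree at most two when `deg φ ≤ 2`
and `deg ψ ≤ 1`. -/
theorem askeyWilson_rel (h : IsDividedDifference α δ ε D) (φ ψ f : ℂ[X]) :
    X ^ 2 * secondOrder D φ ψ f - (4 * C α ^ 2 - 2) * (X * secondOrder D φ ψ (X * f))
      + secondOrder D φ ψ (X ^ 2 * f)
      - 4 * C δ * (1 + C α) * (X * secondOrder D φ ψ f + secondOrder D φ ψ (X * f))
      + (4 * C δ ^ 2 + 8 * C α * C δ ^ 2 + 4 * C α ^ 2 * C ε) * secondOrder D φ ψ f =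
      (2 * C α * φ + (2 * X - 2 * C δ) * ψ) * f := by
  have a := h.sq_mul_comp f
  have b := h.mul_mul_comp f
  have c := h.rel (D f)
  have a' := h.sq_mul_comp (X * f)
  have b' := h.mul_mul_comp (X * f)
  have c' := h.rel (D (X * f))
  rw [show X * (X * f) = X ^ 2 * f by ring] at a' b'
  simp only [secondOrder_apply, a', b', c', a, b, c]
  ring

theorem exists_lift (h : IsDividedDifference α δ ε D) (a0 a1 a2 b0 b1 : ℂ) : ∃ A0 A1 A2 B0 B1 c : ℂ, ∀ f,
    D (secondOrder D (quad A0 A1 A2) (quad B0 B1 0) f) =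
      secondOrder D (quad a0 a1 a2) (quad b0 b1 0) (D f) + C c * D f := by
  -- Normal ordering of `D L` and comparison with `M D + c D` gives a linear system for the new
  -- coefficients. The block expressing `(a2, b1)` in `(A2, B1)` has determinant 1 and the rest is
  -- triangular, so the system is solvable for every `α`.
  obtain ⟨A2, hA2⟩ : ∃ A2, A2 = (4 * α ^ 2 - 1) * a2 + 2 * α * b1 := ⟨_, rfl⟩
  obtain ⟨B1, hB1⟩ : ∃ B1, B1 = -2 * α * a2 - b1 := ⟨_, rfl⟩
  obtain ⟨B0, hB0⟩ : ∃ B0, B0 = 2 * δ * A2 + 4 * α * δ * B1 - a1 := ⟨_, rfl⟩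
  obtain ⟨A1, hA1⟩ : ∃ A1, A1 = b0 - 2 * δ * A2 - 2 * α * B0 - (4 * α * δ + 2 * δ) * B1 :=
    ⟨_, rfl⟩
  obtain ⟨A0, hA0⟩ : ∃ A0, A0 = a0 + ε * A2 - 2 * δ * B0 + 2 * α * ε * B1 := ⟨_, rfl⟩
  refine ⟨A0, A1, A2, B0, B1, B1, fun f => ?_⟩
  have ha2 : a2 = -A2 - 2 * α * B1 := by rw [hA2, hB1]; ring
  have hb1 : b1 = 2 * α * A2 + (4 * α ^ 2 - 1) * B1 := by rw [hA2, hB1]; ring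
  have ha1 : a1 = 2 * δ * A2 - B0 + 4 * α * δ * B1 := by rw [hB0]; ring
  have hb0 : b0 = A1 + 2 * δ * A2 + 2 * α * B0 + (4 * α * δ + 2 * δ) * B1 := by rw [hA1]; ring
  have ha0 : a0 = A0 - ε * A2 + 2 * δ * B0 - 2 * α * ε * B1 := by rw [hA0]; ring
  clear hA0 hA1 hA2 hB0 hB1
  subst ha0 ha1 ha2 hb0 hb1
  have p := h.sq_mul_comp (D f)
  have q := h.mul_mul_comp (D f)
  have r := h.rel (D (D f))
  have e1 : secondOrder D (quad A0 A1 A2) (quad B0 B1 0) f = C A0 * D (D f)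
      + C A1 * (X * D (D f)) + C A2 * (X ^ 2 * D (D f)) + C B0 * D (X * D f)
      + C B1 * (X * D (X * D f)) := by
    simp only [secondOrder_apply, quad, C_0]; ring
  rw [e1]
  simp only [map_add, map_C_mul, p, q, r, secondOrder_apply, quad]
  simp only [C_sub, C_mul, C_add, C_neg, C_pow, C_0, C_1, map_ofNat]
  ring

theorem exists_lift_pow (h : IsDividedDifference α δ ε D) (k : ℕ) (a0 a1 a2 b0 b1 : ℂ) : ∃ A0 A1 A2 B0 B1 c : ℂ, ∀ f,
    (D ^ k) (secondOrder D (quad A0 A1 A2) (quad B0 B1 0) f) =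
      secondOrder D (quad a0 a1 a2) (quad b0 b1 0) ((D ^ k) f) + C c * (D ^ k) f := by
  induction k generalizing a0 a1 a2 b0 b1 with
  | zero => exact ⟨a0, a1, a2, b0, b1, 0, fun f => by simp⟩
  | succ k ih =>
    obtain ⟨a0', a1', a2', b0', b1', c', h'⟩ := h.exists_lift a0 a1 a2 b0 b1
    obtain ⟨A0, A1, A2, B0, B1, c, hA⟩ := ih a0' a1' a2' b0' b1'
    refine ⟨A0, A1, A2, B0, B1, c + c', fun f => ?_⟩
    have hs : ∀ g, (D ^ (k + 1)) g = D ((D ^ k) g) := fun g => by rw [pow_succ']; rfl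
    rw [hs, hA, map_add, map_C_mul, h', hs, C_add]
    ring

/-- The Pearson equation is applied to `Df` times the average of `g`; by `map_leibniz_left` what
remains besides `g * secondOrder D φ ψ f` depends only on `Df * Dg`. The symmetry in `f` and `g`
makes the operator self-adjoint for `v`. -/
theorem exists_form_of_pearson (h : IsDividedDifference α δ ε D) (φ ψ : ℂ[X]) (v : ℂ[X] →ₗ[ℂ] ℂ)
    (hv : ∀ f, v (φ * D f + ψ * D (X * f)) = 0) :
    ∃ w : ℂ[X] →ₗ[ℂ] ℂ, ∀ f g, v (g * secondOrder D φ ψ f) = w (D f * D g) := by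
  let m (f : ℂ[X]) := LinearMap.mulLeft ℂ f
  refine ⟨-(v ∘ₗ (m (φ * C α + ψ * (C α * (2 * C α * X + 2 * C δ) + C δ - X)) ∘ₗ D ∘ₗ m X
    + m (φ * (C δ - X) - ψ * (C α * (X ^ 2 - 2 * C δ * X + C ε))) ∘ₗ D)), fun f g => ?_⟩
  have a := h.map_leibniz_left f g
  have b := hv (D f * (D (X * g) - (C α * X + C δ) * D g))
  rw [a.1, a.2] at b
  simp only [m, LinearMap.neg_apply, LinearMap.comp_apply, LinearMap.add_apply,
    LinearMap.mulLeft_apply, secondOrder_apply]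
  rw [eq_neg_iff_add_eq_zero, ← map_add, ← b]
  congr 1
  ring

end IsDividedDifference

/-! ### The `q`-numbers and the eigenvalues. -/

/-- The numbers `γ n = (q^{n/2} - q^{-n/2}) / (q^{1/2} - q^{-1/2})`, with
`2 α = q^{1/2} + q^{-1/2}`. -/
def qNumber (α : ℂ) : ℕ → ℂ
  | 0 => 0
  | 1 => 1
  | n + 2 => 2 * α * qNumber α (n + 1) - qNumber α n

theorem qNumber_add (α : ℂ) (m i : ℕ) : qNumber α (m + i) =
    qNumber α i * qNumber α (m + 1) - (2 * α * qNumber α i - qNumber α (i + 1)) * qNumber α m := by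
  induction i using Nat.twoStepInduction with
  | zero => simp [qNumber]
  | one => simp [qNumber]
  | more i h1 h2 =>
    have e : qNumber α (m + (i + 2)) = 2 * α * qNumber α (m + (i + 1)) - qNumber α (m + i) := rfl
    have e2 : qNumber α (i + 2) = 2 * α * qNumber α (i + 1) - qNumber α i := rfl
    have e3 : qNumber α (i + 2 + 1) = 2 * α * qNumber α (i + 2) - qNumber α (i + 1) := rfl
    rw [e, h1, h2, e3, e2]
    ring

/-- The invariant quadratic form of the recurrence; it is the determinant 1 behind later inversions.
-/
theorem qNumber_sq (α : ℂ) (n : ℕ) : qNumber α (n + 1) ^ 2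
    - 2 * α * qNumber α n * qNumber α (n + 1) + qNumber α n ^ 2 = 1 := by
  induction n with
  | zero => simp [qNumber]
  | succ n ih =>
    have e : qNumber α (n + 1 + 1) = 2 * α * qNumber α (n + 1) - qNumber α n := rfl
    rw [e]
    linear_combination ih

theorem qNumber_ne_zero {r : ℝ} (hr : 1 ≤ r) (n : ℕ) : qNumber (r : ℂ) (n + 1) ≠ 0 := by
  -- For `r ≥ 1` the increments never decrease: `(2ry - x) - y ≥ y - x ≥ 1`.
  have key : ∀ n : ℕ, ∃ x y : ℝ, qNumber (r : ℂ) n = x ∧ qNumber (r : ℂ) (n + 1) = y ∧ 0 ≤ x ∧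
      x + 1 ≤ y := by
    intro n
    induction n with
    | zero => exact ⟨0, 1, by simp [qNumber]⟩
    | succ n ih =>
      obtain ⟨x, y, hx, hy, h0, h1⟩ := ih
      refine ⟨y, 2 * r * y - x, hy, ?_, by linarith, by nlinarith⟩
      have e : qNumber (r : ℂ) (n + 1 + 1) = 2 * r * qNumber r (n + 1) - qNumber r n := rfl
      rw [e, hx, hy]
      push_cast
      ring
  obtain ⟨x, y, -, hy, h0, h1⟩ := key n
  rw [hy]
  have : y ≠ 0 := by linarith
  exact_mod_cast this

/-- The factor `θ N` of the eigenvalues of `secondOrder`. -/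
def eigenFactor (α a b : ℂ) (n : ℕ) : ℂ := a * qNumber α (n - 1) + b * qNumber α n

/-- The eigenvalues of `secondOrder`. -/
def eigenValue (α a b : ℂ) (n : ℕ) : ℂ := qNumber α n * eigenFactor α a b n

/-- The differences factor, so distinctness of all eigenvalues reduces to nonvanishing of the
`q`-numbers and of `eigenFactor` at positive indices. -/
theorem eigenValue_sub (α a b : ℂ) (m i : ℕ) :
    eigenValue α a b (m + i + 1) - eigenValue α a b m =
      qNumber α (i + 1) * eigenFactor α a b (m + (m + i + 1)) := by
  have hp := qNumber_add α m i
  have hn := qNumber_add α m (i + 1)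
  have hs := qNumber_add α m (m + i + 1)
  have hs' := qNumber_add α m (m + i)
  have hI := qNumber_sq α i
  have e1 : qNumber α (i + 1 + 1) = 2 * α * qNumber α (i + 1) - qNumber α i := rfl
  have e2 : qNumber α (m + i + 1 + 1) = 2 * α * qNumber α (m + i + 1) - qNumber α (m + i) := rfl
  have hm : qNumber α m * qNumber α (m - 1) =
      qNumber α m * (2 * α * qNumber α m - qNumber α (m + 1)) := by
    cases m with
    | zero => simp [qNumber]
    | succ m =>
      have e : qNumber α (m + 1 + 1) = 2 * α * qNumber α (m + 1) - qNumber α m := rfl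
      rw [e, Nat.add_sub_cancel]; ring
  rw [show m + (i + 1) = m + i + 1 by ring] at hn
  simp only [eigenValue, eigenFactor]
  rw [show m + (m + i + 1) - 1 = m + (m + i) by omega, show m + i + 1 - 1 = m + i by omega,
    hs, hs', e2, hn, hp, e1]
  linear_combination -a * hm + (a * (2 * α * qNumber α m ^ 2 - qNumber α m * qNumber α (m + 1))
    + b * qNumber α m ^ 2) * hI

/-- Two consecutive factors form a linear system in `a, b` whose determinant is 1 by `qNumber_sq`.
-/
theorem eq_zero_of_eigenFactor {α a b : ℂ} {n : ℕ} (h1 : eigenFactor α a b (n + 1) = 0)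
    (h2 : eigenFactor α a b (n + 2) = 0) : a = 0 ∧ b = 0 := by
  have hI := qNumber_sq α n
  have e : qNumber α (n + 2) = 2 * α * qNumber α (n + 1) - qNumber α n := rfl
  simp only [eigenFactor, Nat.add_sub_cancel, show n + 2 - 1 = n + 1 by omega, e] at h1 h2
  constructor
  · linear_combination -a * hI + qNumber α (n + 1) * h2
      - (2 * α * qNumber α (n + 1) - qNumber α n) * h1
  · linear_combination -b * hI + qNumber α (n + 1) * h1 - qNumber α n * h2

/-! ### Degree filtration and leading coefficients. -/

theorem sub_mem_degreeLT {f : ℂ[X]} {n : ℕ} (hf : f ∈ degreeLT ℂ (n + 1)) {g : ℂ[X]}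
    (hg : g ∈ degreeLT ℂ (n + 1)) (h : g.coeff n = f.coeff n) : f - g ∈ degreeLT ℂ n := by
  rw [mem_degreeLT, degree_lt_iff_coeff_zero] at *
  intro m hm
  rcases eq_or_lt_of_le hm with rfl | hm
  · simp [h]
  · simp [hf m hm, hg m hm]

theorem X_pow_mem_degreeLT (n : ℕ) : (X ^ n : ℂ[X]) ∈ degreeLT ℂ (n + 1) := by
  rw [mem_degreeLT]
  exact (degree_X_pow_le n).trans_lt (by exact_mod_cast Nat.lt_succ_self n)

theorem C_mul_mem_degreeLT {f : ℂ[X]} {n : ℕ} (a : ℂ) (hf : f ∈ degreeLT ℂ n) :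
    C a * f ∈ degreeLT ℂ n := by
  rw [← smul_eq_C_mul]; exact Submodule.smul_mem _ _ hf

theorem mul_mem_degreeLT {f g : ℂ[X]} {m n : ℕ} (hf : f ∈ degreeLT ℂ (m + 1))
    (hg : g ∈ degreeLT ℂ n) : f * g ∈ degreeLT ℂ (m + n) := by
  rcases eq_or_ne g 0 with rfl | hg0
  · simp
  rcases eq_or_ne f 0 with rfl | hf0
  · simp
  rw [mem_degreeLT] at *
  rw [← natDegree_lt_iff_degree_lt (by assumption)] at hf hg
  rw [← natDegree_lt_iff_degree_lt (mul_ne_zero hf0 hg0), natDegree_mul hf0 hg0]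
  omega

theorem sub_leading_mem_degreeLT {f : ℂ[X]} {n : ℕ} (hf : f ∈ degreeLT ℂ (n + 1)) :
    f - C (f.coeff n) * X ^ n ∈ degreeLT ℂ n :=
  sub_mem_degreeLT hf (C_mul_mem_degreeLT _ (X_pow_mem_degreeLT n)) (by simp)

theorem coeff_of_mem_degreeLT {f : ℂ[X]} {n m : ℕ} (hf : f ∈ degreeLT ℂ n) (h : n ≤ m) :
    f.coeff m = 0 := by
  rw [mem_degreeLT, degree_lt_iff_coeff_zero] at hf
  exact hf m h

theorem mem_degreeLT_natDegree (f : ℂ[X]) : f ∈ degreeLT ℂ (f.natDegree + 1) := by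
  rw [mem_degreeLT]
  exact degree_le_natDegree.trans_lt (by exact_mod_cast Nat.lt_succ_self _)

theorem degreeLT_le {m n : ℕ} (h : m ≤ n) : degreeLT ℂ m ≤ degreeLT ℂ n := degreeLT_mono h

theorem eq_zero_of_mem_degreeLT_zero {f : ℂ[X]} (hf : f ∈ degreeLT ℂ 0) : f = 0 := by
  ext i; exact coeff_of_mem_degreeLT hf (Nat.zero_le i)

theorem eq_C_of_mem_degreeLT_one {f : ℂ[X]} (hf : f ∈ degreeLT ℂ 1) : f = C (f.coeff 0) := by
  have := eq_zero_of_mem_degreeLT_zero (sub_leading_mem_degreeLT hf)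
  simpa [sub_eq_zero] using this

theorem linear_mem_degreeLT (a b : ℂ) : C a + C b * X ∈ degreeLT ℂ 2 := by
  refine Submodule.add_mem _ ?_ (C_mul_mem_degreeLT _ ?_)
  · have := C_mul_mem_degreeLT a (degreeLT_le (by omega : 1 ≤ 2) (X_pow_mem_degreeLT 0))
    simpa using this
  · simpa using X_pow_mem_degreeLT 1

theorem quad_mem_degreeLT (a0 a1 a2 : ℂ) : quad a0 a1 a2 ∈ degreeLT ℂ 3 :=
  Submodule.add_mem _ (degreeLT_le (by omega) (linear_mem_degreeLT a0 a1))
    (C_mul_mem_degreeLT _ (X_pow_mem_degreeLT 2))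

theorem coeff_mul_top {f g : ℂ[X]} {m n : ℕ} (hf : f ∈ degreeLT ℂ (m + 1))
    (hg : g ∈ degreeLT ℂ (n + 1)) : (f * g).coeff (m + n) = f.coeff m * g.coeff n := by
  apply coeff_mul_add_eq_of_natDegree_le
  · rw [natDegree_le_iff_coeff_eq_zero]
    intro i hi
    exact coeff_of_mem_degreeLT hf hi
  · rw [natDegree_le_iff_coeff_eq_zero]
    intro i hi
    exact coeff_of_mem_degreeLT hg hi

namespace IsDividedDifference

variable {α δ ε : ℂ} {D : Module.End ℂ ℂ[X]}

theorem map_X_pow (h : IsDividedDifference α δ ε D) (n : ℕ) :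
    D (X ^ (n + 1)) ∈ degreeLT ℂ (n + 1) ∧ (D (X ^ (n + 1))).coeff n = qNumber α (n + 1) := by
  induction n using Nat.twoStepInduction with
  | zero =>
    have := X_pow_mem_degreeLT 0
    simp only [pow_zero] at this
    simp [h.map_X, qNumber, this]
  | one =>
    have e : D (X ^ (1 + 1)) = C (2 * δ) + C (2 * α) * X := by
      have := h.rel 1
      simp only [mul_one, h.map_one, h.map_X, mul_zero, sub_zero] at this
      rw [show 1 + 1 = 2 from rfl, this]
      simp only [C_mul, map_ofNat]; ring
    rw [e]
    refine ⟨linear_mem_degreeLT _ _, by simp [qNumber, coeff_C]⟩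
  | more n h1 h2 =>
    have e : D (X ^ (n + 2 + 1)) = (C (2 * δ) + C (2 * α) * X) * D (X ^ (n + 1 + 1))
        - quad ε (-(2 * δ)) 1 * D (X ^ (n + 1)) := by
      have := h.rel (X ^ (n + 1))
      rw [show X ^ (n + 2 + 1) = X ^ 2 * (X ^ (n + 1) : ℂ[X]) by ring, this, ← pow_succ', quad]
      simp only [C_mul, C_neg, C_1, map_ofNat]; ring
    have l1 := linear_mem_degreeLT (2 * δ) (2 * α)
    have l2 := quad_mem_degreeLT ε (-(2 * δ)) 1
    have m1 := mul_mem_degreeLT l1 h2.1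
    have m2 := mul_mem_degreeLT l2 h1.1
    have c1 := coeff_mul_top l1 h2.1
    have c2 := coeff_mul_top l2 h1.1
    rw [show 1 + (n + 1 + 1) = n + 2 + 1 by ring] at m1
    rw [show 2 + (n + 1) = n + 2 + 1 by ring] at m2
    rw [show 1 + (n + 1) = n + 2 by ring, h2.2] at c1
    rw [show 2 + n = n + 2 by ring, h1.2] at c2
    rw [e]
    refine ⟨Submodule.sub_mem _ m1 m2, ?_⟩
    rw [coeff_sub, c1, c2]
    simp [quad, coeff_C, coeff_X_pow, qNumber]

theorem map_degreeLT (h : IsDividedDifference α δ ε D) (n : ℕ) :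
    ∀ f ∈ degreeLT ℂ (n + 1), D f ∈ degreeLT ℂ n := by
  induction n with
  | zero =>
    intro f hf
    rw [eq_C_of_mem_degreeLT_one hf, ← mul_one (C _), map_C_mul, h.map_one, mul_zero]
    exact Submodule.zero_mem _
  | succ n ih =>
    intro f hf
    have h1 := ih _ (sub_leading_mem_degreeLT hf)
    have h2 := C_mul_mem_degreeLT (f.coeff (n + 1)) (h.map_X_pow n).1
    rw [← map_C_mul] at h2
    have := Submodule.add_mem _ (degreeLT_le (Nat.le_succ n) h1) h2
    rwa [← map_add, sub_add_cancel] at this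

theorem coeff_map (h : IsDividedDifference α δ ε D) (n : ℕ) {f : ℂ[X]}
    (hf : f ∈ degreeLT ℂ (n + 2)) : (D f).coeff n = qNumber α (n + 1) * f.coeff (n + 1) := by
  have h1 := coeff_of_mem_degreeLT (h.map_degreeLT n _ (sub_leading_mem_degreeLT hf)) le_rfl
  rw [map_sub, map_C_mul, coeff_sub, coeff_C_mul, (h.map_X_pow n).2] at h1
  linear_combination h1

theorem mem_degreeLT_of_map (h : IsDividedDifference α δ ε D) (hα : ∀ n, qNumber α (n + 1) ≠ 0)
    {n : ℕ} {f : ℂ[X]} (hf : D f ∈ degreeLT ℂ n) : f ∈ degreeLT ℂ (n + 1) := by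
  by_contra hn
  have hd : n + 1 ≤ f.natDegree := by
    by_contra hd
    exact hn (degreeLT_le (by omega) (mem_degreeLT_natDegree f))
  obtain ⟨d, hd'⟩ : ∃ d, f.natDegree = d + 1 := ⟨f.natDegree - 1, by omega⟩
  have hm := mem_degreeLT_natDegree f
  rw [hd'] at hm
  have h1 := h.coeff_map d hm
  rw [coeff_of_mem_degreeLT hf (by omega)] at h1
  have h2 : f.coeff (d + 1) ≠ 0 := by
    rw [← hd', coeff_natDegree, leadingCoeff_ne_zero]
    rintro rfl
    simp at hd
  exact mul_ne_zero (hα d) h2 h1.symm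

theorem mem_degreeLT_of_pow (h : IsDividedDifference α δ ε D) (hα : ∀ n, qNumber α (n + 1) ≠ 0)
    (k : ℕ) {n : ℕ} {f : ℂ[X]} (hf : (D ^ k) f ∈ degreeLT ℂ n) : f ∈ degreeLT ℂ (n + k) := by
  induction k generalizing n with
  | zero => exact hf
  | succ k ih =>
    rw [pow_succ'] at hf
    have := ih (h.mem_degreeLT_of_map hα hf)
    rwa [show n + (k + 1) = n + 1 + k by ring]

/-- `D` lowers the degree by exactly one, with leading factor a nonzero `q`-number, so preimages are
built from the top coefficient down. -/
theorem surjective (h : IsDividedDifference α δ ε D) (hα : ∀ n, qNumber α (n + 1) ≠ 0) :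
    Function.Surjective D := by
  have key : ∀ n, ∀ g ∈ degreeLT ℂ n, ∃ f, D f = g := by
    intro n
    induction n with
    | zero => intro g hg; exact ⟨0, by rw [eq_zero_of_mem_degreeLT_zero hg, map_zero]⟩
    | succ n ih =>
      intro g hg
      have h1 : g - C (g.coeff n / qNumber α (n + 1)) * D (X ^ (n + 1)) ∈ degreeLT ℂ n := by
        refine sub_mem_degreeLT hg (C_mul_mem_degreeLT _ (h.map_X_pow n).1) ?_
        rw [coeff_C_mul, (h.map_X_pow n).2, div_mul_cancel₀ _ (hα n)]
      obtain ⟨f, hf⟩ := ih _ h1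
      exact ⟨f + C (g.coeff n / qNumber α (n + 1)) * X ^ (n + 1), by
        rw [map_add, map_C_mul, hf, sub_add_cancel]⟩
  exact fun g => key _ g (mem_degreeLT_natDegree g)

theorem pow_surjective (h : IsDividedDifference α δ ε D) (hα : ∀ n, qNumber α (n + 1) ≠ 0)
    (k : ℕ) : Function.Surjective (D ^ k) := by
  induction k with
  | zero => exact fun f => ⟨f, rfl⟩
  | succ k ih => rw [pow_succ']; exact (h.surjective hα).comp ih

theorem secondOrder_mem_degreeLT (h : IsDividedDifference α δ ε D) (a0 a1 a2 b0 b1 : ℂ) (n : ℕ)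
    {f : ℂ[X]} (hf : f ∈ degreeLT ℂ n) :
    secondOrder D (quad a0 a1 a2) (quad b0 b1 0) f ∈ degreeLT ℂ n := by
  have hb : quad b0 b1 0 = C b0 + C b1 * X := by simp [quad]
  rw [secondOrder_apply, hb]
  match n with
  | 0 => rw [eq_zero_of_mem_degreeLT_zero hf]; simp
  | 1 =>
    rw [eq_zero_of_mem_degreeLT_zero (h.map_degreeLT 0 f hf)]; simp
  | n + 2 =>
    have h1 := h.map_degreeLT _ f hf
    have h2 := h.map_degreeLT _ _ h1
    have h3 : X * D f ∈ degreeLT ℂ (n + 1 + 1) := by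
      have := mul_mem_degreeLT (X_pow_mem_degreeLT 1) h1
      rwa [pow_one, add_comm] at this
    have h4 := h.map_degreeLT _ _ h3
    have h5 := mul_mem_degreeLT (quad_mem_degreeLT a0 a1 a2) h2
    have h6 := mul_mem_degreeLT (linear_mem_degreeLT b0 b1) h4
    rw [show 2 + n = n + 2 by ring] at h5
    rw [show 1 + (n + 1) = n + 2 by ring] at h6
    exact Submodule.add_mem _ h5 h6

theorem coeff_secondOrder (h : IsDividedDifference α δ ε D) (a0 a1 a2 b0 b1 : ℂ) (n : ℕ)
    {f : ℂ[X]} (hf : f ∈ degreeLT ℂ (n + 1)) :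
    (secondOrder D (quad a0 a1 a2) (quad b0 b1 0) f).coeff n =
      eigenValue α a2 b1 n * f.coeff n := by
  have hb : quad b0 b1 0 = C b0 + C b1 * X := by simp [quad]
  rw [secondOrder_apply, hb]
  match n with
  | 0 =>
    rw [eq_zero_of_mem_degreeLT_zero (h.map_degreeLT 0 f hf)]; simp [eigenValue, qNumber]
  | n + 1 =>
    have h1 := h.map_degreeLT _ f hf
    have c1 := h.coeff_map n hf
    have h3 : X * D f ∈ degreeLT ℂ (n + 1 + 1) := by
      have := mul_mem_degreeLT (X_pow_mem_degreeLT 1) h1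
      rwa [pow_one, add_comm] at this
    have h4 := h.map_degreeLT _ _ h3
    have c4 := h.coeff_map n h3
    rw [coeff_X_mul, c1] at c4
    have h6 := coeff_mul_top (linear_mem_degreeLT b0 b1) h4
    rw [show 1 + n = n + 1 by ring, c4] at h6
    rw [coeff_add, h6]
    cases n with
    | zero =>
      rw [eq_zero_of_mem_degreeLT_zero (h.map_degreeLT 0 _ h1)]
      simp [eigenValue, eigenFactor, qNumber, coeff_C]
    | succ n =>
      have h2 := h.map_degreeLT _ _ h1
      have c2 := h.coeff_map n h1
      have h5 := coeff_mul_top (quad_mem_degreeLT a0 a1 a2) h2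
      rw [show 2 + n = n + 1 + 1 by ring, c2, c1] at h5
      rw [h5]
      simp [eigenValue, eigenFactor, quad, coeff_C]
      ring

end IsDividedDifference

/-! ### Orthogonality and the filtration opposite to the degree. -/

/-- The sequence `p` is orthogonal for the functional `u`. -/
structure IsOrthogonalFor (p : ℕ → ℂ[X]) (u : ℂ[X] →ₗ[ℂ] ℂ) : Prop where
  degree_eq : ∀ n, (p n).degree = n
  ortho : ∀ m n, m ≠ n → u (p m * p n) = 0
  norm_ne : ∀ n, u (p n * p n) ≠ 0

/-- Polynomials orthogonal to all polynomials of degree less than `n`. -/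
def orthoLT (u : ℂ[X] →ₗ[ℂ] ℂ) (n : ℕ) : Submodule ℂ ℂ[X] where
  carrier := {f | ∀ g ∈ degreeLT ℂ n, u (f * g) = 0}
  add_mem' := fun {a b} ha hb g hg => by rw [add_mul, map_add, ha g hg, hb g hg, add_zero]
  zero_mem' := fun g _ => by simp
  smul_mem' := fun c f hf g hg => by rw [smul_mul_assoc, map_smul, hf g hg, smul_zero]

theorem orthoLT_le (u : ℂ[X] →ₗ[ℂ] ℂ) {m n : ℕ} (h : m ≤ n) : orthoLT u n ≤ orthoLT u m :=
  fun _ hf g hg => hf g (degreeLT_le h hg)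

theorem C_mul_mem_orthoLT {u : ℂ[X] →ₗ[ℂ] ℂ} {n : ℕ} (a : ℂ) {f : ℂ[X]} (hf : f ∈ orthoLT u n) :
    C a * f ∈ orthoLT u n := by
  rw [← smul_eq_C_mul]; exact Submodule.smul_mem _ _ hf

theorem mul_mem_orthoLT {u : ℂ[X] →ₗ[ℂ] ℂ} {m n : ℕ} {f g : ℂ[X]} (hf : f ∈ degreeLT ℂ (m + 1))
    (hg : g ∈ orthoLT u (m + n)) : f * g ∈ orthoLT u n := by
  intro r hr
  rw [show f * g * r = g * (f * r) by ring]
  exact hg _ (mul_mem_degreeLT hf hr)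

namespace IsOrthogonalFor

variable {p : ℕ → ℂ[X]} {u : ℂ[X] →ₗ[ℂ] ℂ}

theorem mem_degreeLT (h : IsOrthogonalFor p u) (n : ℕ) : p n ∈ degreeLT ℂ (n + 1) := by
  rw [Polynomial.mem_degreeLT, h.degree_eq]
  exact_mod_cast Nat.lt_succ_self n

theorem coeff_ne (h : IsOrthogonalFor p u) (n : ℕ) : (p n).coeff n ≠ 0 := by
  have h1 := natDegree_eq_of_degree_eq_some (h.degree_eq n)
  have : (p n).leadingCoeff ≠ 0 := by
    rw [leadingCoeff_ne_zero]
    intro h0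
    have := h.degree_eq n
    rw [h0, degree_zero] at this
    cases this
  rwa [leadingCoeff, h1] at this

theorem sub_mem_degreeLT (h : IsOrthogonalFor p u) {n : ℕ} {f : ℂ[X]}
    (hf : f ∈ degreeLT ℂ (n + 1)) : f - C (f.coeff n / (p n).coeff n) * p n ∈ degreeLT ℂ n := by
  refine _root_.sub_mem_degreeLT hf (C_mul_mem_degreeLT _ (h.mem_degreeLT n)) ?_
  rw [coeff_C_mul, div_mul_cancel₀ _ (h.coeff_ne n)]

theorem degreeLT_induction (h : IsOrthogonalFor p u) {P : ℂ[X] → Prop} (h0 : P 0)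
    (hadd : ∀ f g, P f → P g → P (f + g)) (hC : ∀ a f, P f → P (C a * f)) (n : ℕ)
    (hp : ∀ i < n, P (p i)) : ∀ f ∈ degreeLT ℂ n, P f := by
  induction n with
  | zero => intro f hf; rwa [eq_zero_of_mem_degreeLT_zero hf]
  | succ n ih =>
    intro f hf
    rw [← sub_add_cancel f (C (f.coeff n / (p n).coeff n) * p n)]
    exact hadd _ _ (ih (fun i hi => hp i (by omega)) _ (h.sub_mem_degreeLT hf))
      (hC _ _ (hp n (by omega)))

theorem mem_orthoLT (h : IsOrthogonalFor p u) (n : ℕ) : p n ∈ orthoLT u n := by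
  refine h.degreeLT_induction (by simp) ?_ ?_ n ?_
  · intro f g hf hg; rw [mul_add, map_add, hf, hg, add_zero]
  · intro a f hf
    rw [show p n * (C a * f) = C a * (p n * f) by ring, map_C_mul', hf, mul_zero]
  · intro i hi
    exact h.ortho _ _ (by omega)

theorem map_mul_eq (h : IsOrthogonalFor p u) {n : ℕ} {f : ℂ[X]} (hf : f ∈ degreeLT ℂ (n + 1)) :
    u (p n * f) = f.coeff n / (p n).coeff n * u (p n * p n) := by
  have := h.mem_orthoLT n _ (h.sub_mem_degreeLT hf)
  rw [mul_sub, map_sub, show ∀ c, p n * (C c * p n) = C c * (p n * p n) from fun c => by ring,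
    map_C_mul'] at this
  linear_combination this

theorem eq_zero_of_mem (h : IsOrthogonalFor p u) (n : ℕ) : ∀ f ∈ degreeLT ℂ n, f ∈ orthoLT u n →
    f = 0 := by
  induction n with
  | zero => intro f hf _; exact eq_zero_of_mem_degreeLT_zero hf
  | succ n ih =>
    intro f hf hu
    have h1 := hu _ (h.mem_degreeLT n)
    rw [mul_comm, h.map_mul_eq hf] at h1
    have h2 : f.coeff n = 0 := by
      rcases mul_eq_zero.mp h1 with h1 | h1
      · exact (div_eq_zero_iff.mp h1).resolve_right (h.coeff_ne n)
      · exact absurd h1 (h.norm_ne n)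
    have h3 := sub_leading_mem_degreeLT hf
    rw [h2, C_0, zero_mul, sub_zero] at h3
    exact ih f h3 (orthoLT_le u (Nat.le_succ n) hu)

theorem sub_mem_orthoLT (h : IsOrthogonalFor p u) {n : ℕ} {f : ℂ[X]} (hf : f ∈ orthoLT u n) :
    f - C (u (f * p n) / u (p n * p n)) * p n ∈ orthoLT u (n + 1) := by
  intro g hg
  rw [← sub_add_cancel g (C (g.coeff n / (p n).coeff n) * p n), mul_add, map_add,
    Submodule.sub_mem _ hf (C_mul_mem_orthoLT _ (h.mem_orthoLT n)) _ (h.sub_mem_degreeLT hg),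
    zero_add, show ∀ r c, r * (C c * p n) = C c * (r * p n) from fun r c => by ring, map_C_mul',
    sub_mul, map_sub, mul_assoc, map_C_mul', div_mul_cancel₀ _ (h.norm_ne n), sub_self, mul_zero]

/-- The space orthogonal to degrees below `n` is spanned by the `p i` with `i ≥ n`. -/
theorem orthoLT_induction (h : IsOrthogonalFor p u) {P : ℂ[X] → Prop} (h0 : P 0)
    (hadd : ∀ f g, P f → P g → P (f + g)) (hC : ∀ a f, P f → P (C a * f)) (n : ℕ)
    (hp : ∀ i, n ≤ i → P (p i)) : ∀ f ∈ orthoLT u n, P f := by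
  have key : ∀ d, ∀ f ∈ degreeLT ℂ d, f ∈ orthoLT u n → P f := by
    intro d
    induction d with
    | zero => intro f hf _; rwa [eq_zero_of_mem_degreeLT_zero hf]
    | succ d ih =>
      intro f hf hu
      by_cases hd : d < n
      · rwa [h.eq_zero_of_mem n f (degreeLT_le hd hf) hu]
      · rw [← sub_add_cancel f (C (f.coeff d / (p d).coeff d) * p d)]
        exact hadd _ _ (ih _ (h.sub_mem_degreeLT hf) (Submodule.sub_mem _ hu
          (C_mul_mem_orthoLT _ (orthoLT_le u (not_lt.mp hd) (h.mem_orthoLT d)))))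
          (hC _ _ (hp d (not_lt.mp hd)))
  exact fun f hf => key _ f (mem_degreeLT_natDegree f) hf

theorem eq_C_mul (h : IsOrthogonalFor p u) {n : ℕ} {f : ℂ[X]} (hf : f ∈ degreeLT ℂ (n + 1))
    (hu : f ∈ orthoLT u n) : f = C (f.coeff n / (p n).coeff n) * p n := by
  rw [← sub_eq_zero]
  exact h.eq_zero_of_mem n _ (h.sub_mem_degreeLT hf)
    (Submodule.sub_mem _ hu (C_mul_mem_orthoLT _ (h.mem_orthoLT n)))

end IsOrthogonalFor

theorem eq_quad_of_mem_degreeLT {f : ℂ[X]} (hf : f ∈ degreeLT ℂ 3) :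
    f = quad (f.coeff 0) (f.coeff 1) (f.coeff 2) := by
  ext i
  match i with
  | 0 => simp [quad]
  | 1 => simp [quad, coeff_C]
  | 2 => simp [quad]
  | i + 3 =>
    rw [coeff_of_mem_degreeLT hf (by omega),
      coeff_of_mem_degreeLT (quad_mem_degreeLT _ _ _) (by omega)]

/-! ### From orthogonality of the derivatives to a second order eigenvalue equation. -/

namespace IsDividedDifference

variable {α δ ε : ℂ} {D : Module.End ℂ ℂ[X]} {p : ℕ → ℂ[X]} {u v : ℂ[X] →ₗ[ℂ] ℂ}

theorem pow_mem_orthoLT (hu : IsOrthogonalFor p u) (k : ℕ)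
    (hv : IsOrthogonalFor (fun n => (D ^ k) (p (n + k))) v) (n : ℕ) :
    ∀ f ∈ orthoLT u (n + k), (D ^ k) f ∈ orthoLT v n := by
  refine hu.orthoLT_induction (by simp) ?_ ?_ _ ?_
  · intro f g hf hg
    rw [map_add]
    exact Submodule.add_mem _ hf hg
  · intro a f hf
    rw [map_C_mul]
    exact C_mul_mem_orthoLT a hf
  · intro i hi
    obtain ⟨j, rfl⟩ := Nat.exists_eq_add_of_le hi
    have := hv.mem_orthoLT (n + j)
    rw [show n + k + j = n + j + k by ring]
    exact orthoLT_le v (by omega) this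

theorem pow_map_degreeLT (h : IsDividedDifference α δ ε D) (k : ℕ) {n : ℕ} {f : ℂ[X]}
    (hf : f ∈ degreeLT ℂ (n + k)) : (D ^ k) f ∈ degreeLT ℂ n := by
  induction k generalizing f with
  | zero => exact hf
  | succ k ih =>
    rw [pow_succ]
    exact ih (h.map_degreeLT _ _ hf)

theorem exists_pearson (h : IsDividedDifference α δ ε D) (hα : ∀ n, qNumber α (n + 1) ≠ 0)
    (hu : IsOrthogonalFor p u) (k : ℕ)
    (hv : IsOrthogonalFor (fun n => (D ^ (k + 1)) (p (n + (k + 1)))) v) :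
    ∃ φ ∈ degreeLT ℂ 3, ∀ f, v (φ * D f + (D ^ (k + 1)) (p (1 + (k + 1))) * D (X * f)) = 0 := by
  set Q : ℕ → ℂ[X] := fun n => (D ^ (k + 1)) (p (n + (k + 1))) with hQ
  set e : ℕ → ℂ := fun m => v (Q 1 * D (X * (D ^ k) (p (m + (k + 1))))) with he
  -- The numbers `e m` measure the failure of `v(Q 1 * D(X ·))` to vanish on the preimages `(D ^ k)
  -- (p (m + (k + 1)))` of `Q m`. By `pow_comp_mul` they involve only `X * p` and `X * Q`, which
  -- shift indices by at most one; hence orthogonality to `Q 1` kills all but `e 0`, `e 1`, `e 2`.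
  have hX : (X : ℂ[X]) ∈ degreeLT ℂ (1 + 1) := by simpa using X_pow_mem_degreeLT 1
  have he0 : ∀ m, 3 ≤ m → e m = 0 := by
    intro m hm
    obtain ⟨m, rfl⟩ : ∃ n, m = n + 1 := ⟨m - 1, by omega⟩
    obtain ⟨c, hc⟩ := h.pow_comp_mul (qNumber α) rfl rfl (fun _ => rfl) k
    have hf := hc (p (m + 1 + (k + 1)))
    have m1 : X * p (m + 1 + (k + 1)) ∈ orthoLT u (m + (k + 1)) :=
      mul_mem_orthoLT hX (by
        rw [show 1 + (m + (k + 1)) = m + 1 + (k + 1) by ring]; exact hu.mem_orthoLT _)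
    have m2 := pow_mem_orthoLT hu (k + 1) hv m _ m1
    have m3 : X * Q (m + 1) ∈ orthoLT v m :=
      mul_mem_orthoLT hX (by rw [add_comm]; exact hv.mem_orthoLT _)
    have hQ1 := degreeLT_le (show 1 + 1 ≤ m by omega) (hv.mem_degreeLT 1)
    have z1 := m2 _ hQ1
    have z2 := m3 _ hQ1
    have z3 := (orthoLT_le v (Nat.le_succ m) (hv.mem_orthoLT (m + 1))) _ hQ1
    have : qNumber α (k + 1) * e (m + 1) = 0 := by
      rw [he]
      simp only
      rw [← map_C_mul', show C (qNumber α (k + 1)) * (Q 1 * D (X * (D ^ k) (p (m + 1 + (k + 1)))))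
        = (D ^ (k + 1)) (X * p (m + 1 + (k + 1))) * Q 1
          + C (qNumber α k) * (X * Q (m + 1) * Q 1) - C c * (Q (m + 1) * Q 1) by
        rw [hf]; simp only [hQ]; ring, map_sub, map_add, map_C_mul', map_C_mul', z1, z2, z3]
      simp
    exact (mul_eq_zero.mp this).resolve_left (hα k)
  -- The polynomial of degree at most two whose pairings with `Q 0, Q 1, Q 2` cancel the three
  -- surviving `e m`.
  refine ⟨C (-(e 0 / v (Q 0 * Q 0))) * Q 0 + C (-(e 1 / v (Q 1 * Q 1))) * Q 1
    + C (-(e 2 / v (Q 2 * Q 2))) * Q 2, ?_, ?_⟩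
  · exact Submodule.add_mem _ (Submodule.add_mem _
      (C_mul_mem_degreeLT _ (degreeLT_le (by omega) (hv.mem_degreeLT 0)))
      (C_mul_mem_degreeLT _ (degreeLT_le (by omega) (hv.mem_degreeLT 1))))
      (C_mul_mem_degreeLT _ (hv.mem_degreeLT 2))
  set φ := C (-(e 0 / v (Q 0 * Q 0))) * Q 0 + C (-(e 1 / v (Q 1 * Q 1))) * Q 1
    + C (-(e 2 / v (Q 2 * Q 2))) * Q 2 with hφ
  intro f
  obtain ⟨g, rfl⟩ := h.pow_surjective hα k f
  refine hu.degreeLT_induction (P := fun g => v (φ * D ((D ^ k) g) + Q 1 * D (X * (D ^ k) g)) = 0)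
    (by simp) ?_ ?_ _ ?_ g (mem_degreeLT_natDegree g)
  · intro f g hf hg
    have e : φ * D ((D ^ k) (f + g)) + Q 1 * D (X * (D ^ k) (f + g)) =
        (φ * D ((D ^ k) f) + Q 1 * D (X * (D ^ k) f))
          + (φ * D ((D ^ k) g) + Q 1 * D (X * (D ^ k) g)) := by
      simp only [map_add, mul_add]; ring
    rw [e, map_add, hf, hg, add_zero]
  · intro a f hf
    rw [map_C_mul, map_C_mul, show X * (C a * (D ^ k) f) = C a * (X * (D ^ k) f) by ring,
      map_C_mul, show φ * (C a * D ((D ^ k) f)) + Q 1 * (C a * D (X * (D ^ k) f)) =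
        C a * (φ * D ((D ^ k) f) + Q 1 * D (X * (D ^ k) f)) by ring, map_C_mul', hf, mul_zero]
  · intro i _
    rcases Nat.lt_or_ge i (k + 1) with hi | hi
    · have h1 := eq_C_of_mem_degreeLT_one (h.pow_map_degreeLT k (n := 1)
        (degreeLT_le (by omega) (hu.mem_degreeLT i)))
      have h2 := hv.mem_orthoLT 1 1 (by simpa using X_pow_mem_degreeLT 0)
      rw [mul_one] at h2
      rw [h1, ← mul_one (C _), show ∀ c, X * (C c * (1 : ℂ[X])) = C c * X from fun c => by ring,
        map_C_mul, map_C_mul, h.map_one, h.map_X, mul_zero, mul_zero, zero_add, mul_one, mul_comm,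
        map_C_mul', h2, mul_zero]
    · obtain ⟨m, rfl⟩ := Nat.exists_eq_add_of_le' hi
      have hD : D ((D ^ k) (p (m + (k + 1)))) = Q m := by
        simp only [hQ]; rw [pow_succ']; rfl
      rw [map_add, hD, ← show e m = v (Q 1 * D (X * (D ^ k) (p (m + (k + 1))))) from rfl]
      have ho := hv.ortho
      have hne := hv.norm_ne
      rw [hφ, add_mul, add_mul, map_add, map_add, mul_assoc, mul_assoc, mul_assoc, map_C_mul',
        map_C_mul', map_C_mul']
      match m with
      | 0 =>
        rw [ho 1 0 (by omega), ho 2 0 (by omega)]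
        have := hne 0
        field_simp
        ring
      | 1 =>
        rw [ho 0 1 (by omega), ho 2 1 (by omega)]
        have := hne 1
        field_simp
        ring
      | 2 =>
        rw [ho 0 2 (by omega), ho 1 2 (by omega)]
        have := hne 2
        field_simp
        ring
      | m + 3 =>
        rw [ho 0 (m + 3) (by omega), ho 1 (m + 3) (by omega), ho 2 (m + 3) (by omega),
          he0 (m + 3) (by omega)]
        simp

/-- A symmetric operator preserving the degree filtration preserves its orthogonal complements. -/
theorem secondOrder_mem_orthoLT_of_pearson (h : IsDividedDifference α δ ε D)
    (a0 a1 a2 b0 b1 : ℂ) (hv : ∀ f, v (quad a0 a1 a2 * D f + quad b0 b1 0 * D (X * f)) = 0)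
    {n : ℕ} {f : ℂ[X]} (hf : f ∈ orthoLT v n) :
    secondOrder D (quad a0 a1 a2) (quad b0 b1 0) f ∈ orthoLT v n := by
  obtain ⟨w, hw⟩ := h.exists_form_of_pearson _ _ v hv
  intro g hg
  rw [mul_comm, hw, mul_comm, ← hw]
  exact hf _ (h.secondOrder_mem_degreeLT a0 a1 a2 b0 b1 n hg)

theorem askeyWilson_rel' (h : IsDividedDifference α δ ε D) (a0 a1 a2 b0 b1 : ℂ) :
    ∃ π ∈ degreeLT ℂ 3, ∃ c1 c2 c3 : ℂ, ∀ f,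
    X ^ 2 * secondOrder D (quad a0 a1 a2) (quad b0 b1 0) f
      + secondOrder D (quad a0 a1 a2) (quad b0 b1 0) (X ^ 2 * f) =
    π * f + C c1 * (X * secondOrder D (quad a0 a1 a2) (quad b0 b1 0) (X * f))
      + C c2 * (X * secondOrder D (quad a0 a1 a2) (quad b0 b1 0) f
        + secondOrder D (quad a0 a1 a2) (quad b0 b1 0) (X * f))
      + C c3 * secondOrder D (quad a0 a1 a2) (quad b0 b1 0) f := by
  refine ⟨C (2 * α) * quad a0 a1 a2 + (C (-(2 * δ)) + C 2 * X) * (C b0 + C b1 * X), ?_,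
    4 * α ^ 2 - 2, 4 * δ * (1 + α), -(4 * δ ^ 2 + 8 * α * δ ^ 2 + 4 * α ^ 2 * ε), fun f => ?_⟩
  · have hm := mul_mem_degreeLT (linear_mem_degreeLT (-(2 * δ)) 2) (linear_mem_degreeLT b0 b1)
    exact Submodule.add_mem _ (C_mul_mem_degreeLT _ (quad_mem_degreeLT a0 a1 a2)) hm
  · have := h.askeyWilson_rel (quad a0 a1 a2) (quad b0 b1 0) f
    have hb : quad b0 b1 0 = C b0 + C b1 * X := by simp [quad]
    rw [← hb]
    simp only [C_sub, C_mul, C_add, C_neg, C_pow, C_1, map_ofNat]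
    linear_combination this

/-- `L p_i` is known only modulo degree less than `k`, and only for `i ≥ k`. The relation
`askeyWilson_rel'` first removes the remainder for large indices, then descends to small ones. -/
theorem secondOrder_mem_orthoLT (h : IsDividedDifference α δ ε D) (hu : IsOrthogonalFor p u)
    (a0 a1 a2 b0 b1 : ℂ) (k : ℕ) (hk : ∀ i, k ≤ i →
      secondOrder D (quad a0 a1 a2) (quad b0 b1 0) (p i) ∈ orthoLT u i ⊔ degreeLT ℂ k) :
    ∀ n, ∀ f ∈ orthoLT u n,
      secondOrder D (quad a0 a1 a2) (quad b0 b1 0) f ∈ orthoLT u n := by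
  obtain ⟨π, hπ, c1, c2, c3, hE⟩ := h.askeyWilson_rel' a0 a1 a2 b0 b1
  set L := secondOrder D (quad a0 a1 a2) (quad b0 b1 0) with hL
  have hX : (X : ℂ[X]) ∈ degreeLT ℂ (1 + 1) := by simpa using X_pow_mem_degreeLT 1
  have hXV : ∀ {N : ℕ} {f : ℂ[X]}, f ∈ orthoLT u (N + 1) → X * f ∈ orthoLT u N := fun hf =>
    mul_mem_orthoLT hX (by rwa [add_comm])
  have hX2V : ∀ {N : ℕ} {f : ℂ[X]}, f ∈ orthoLT u (N + 2) → X ^ 2 * f ∈ orthoLT u N := fun hf =>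
    mul_mem_orthoLT (X_pow_mem_degreeLT 2) (by rwa [add_comm])
  have hCS : ∀ {N t : ℕ} {f : ℂ[X]} (c : ℂ), f ∈ orthoLT u N ⊔ degreeLT ℂ t →
      C c * f ∈ orthoLT u N ⊔ degreeLT ℂ t := fun c hf => by
    rw [← smul_eq_C_mul]; exact Submodule.smul_mem _ _ hf
  have hXS : ∀ {N t : ℕ} {f : ℂ[X]}, f ∈ orthoLT u (N + 1) ⊔ degreeLT ℂ t →
      X * f ∈ orthoLT u N ⊔ degreeLT ℂ (t + 1) := by
    intro N t f hf
    obtain ⟨a, ha, b, hb, rfl⟩ := Submodule.mem_sup.mp hf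
    rw [mul_add]
    refine Submodule.add_mem_sup (hXV ha) ?_
    rw [add_comm]; exact mul_mem_degreeLT hX hb
  have hle : ∀ {N N' t t' : ℕ}, N ≤ N' → t' ≤ t →
      orthoLT u N' ⊔ degreeLT ℂ t' ≤ orthoLT u N ⊔ degreeLT ℂ t := fun h1 h2 =>
    sup_le_sup (orthoLT_le u h1) (degreeLT_le h2)
  -- The remainder bound drops by one at each stage. In the relation, `X² L f` may have a remainder
  -- of degree `t + 2`, every other term at most `t + 1`. For large `N`, low degree and
  -- orthogonality meet only in 0, so the coefficient of degree `t` in the remainder `b` of `L f`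
  -- vanishes.
  have claim1 : ∀ j t, j + t = k → ∃ N0, ∀ N, N0 ≤ N → ∀ f ∈ orthoLT u N,
      L f ∈ orthoLT u N ⊔ degreeLT ℂ t := by
    intro j
    induction j with
    | zero =>
      intro t ht
      refine ⟨k, fun N hN => hu.orthoLT_induction (by simp) ?_ ?_ N ?_⟩
      · intro f g hf hg
        rw [map_add]; exact Submodule.add_mem _ hf hg
      · intro a f hf
        rw [map_C_mul]; exact hCS a hf
      · intro i hi
        exact hle hi (by omega) (hk i (by omega))
    | succ j ih =>
      intro t ht
      obtain ⟨N0, hN0⟩ := ih (t + 1) (by omega)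
      refine ⟨N0 + t + 5, fun N' hN' f hf => ?_⟩
      obtain ⟨N, rfl⟩ : ∃ N, N' = N + 2 := ⟨N' - 2, by omega⟩
      have hLf := hN0 (N + 2) (by omega) f hf
      have m0 : π * f ∈ orthoLT u N ⊔ degreeLT ℂ (t + 2) :=
        Submodule.mem_sup_left (mul_mem_orthoLT hπ (by rwa [add_comm]))
      have hXf := hN0 (N + 1) (by omega) _ (hXV hf)
      have m1 := hCS c1 (hXS hXf)
      have m2 := hCS c2 (Submodule.add_mem _ (hXS (hle (by omega : N + 1 ≤ N + 2) le_rfl hLf))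
        (hle (by omega : N ≤ N + 1) (by omega : t + 1 ≤ t + 1 + 1) hXf))
      have m3 := hCS c3 (hle (by omega : N ≤ N + 2) (by omega : t + 1 ≤ t + 2) hLf)
      have m4 := hle (le_refl N) (by omega : t + 1 ≤ t + 2) (hN0 N (by omega) _ (hX2V hf))
      have m5 := Submodule.sub_mem _ (Submodule.add_mem _ (Submodule.add_mem _
        (Submodule.add_mem _ m0 m1) m2) m3) m4
      rw [← hE f, add_sub_cancel_right] at m5
      obtain ⟨a, ha, b, hb, hab⟩ := Submodule.mem_sup.mp hLf
      rw [← hab] at m5 ⊢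
      obtain ⟨a', ha', b', hb', hab'⟩ := Submodule.mem_sup.mp m5
      have hb2 : X ^ 2 * b ∈ degreeLT ℂ (t + 3) := by
        have := mul_mem_degreeLT (X_pow_mem_degreeLT 2) hb
        rwa [show 2 + (t + 1) = t + 3 by ring] at this
      have hz : X ^ 2 * b - b' = 0 := by
        refine hu.eq_zero_of_mem N _ (degreeLT_le (by omega : t + 3 ≤ N)
          (Submodule.sub_mem _ hb2 (degreeLT_le (by omega) hb'))) ?_
        rw [show X ^ 2 * b - b' = a' - X ^ 2 * a by linear_combination -hab']
        exact Submodule.sub_mem _ ha' (hX2V ha)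
      have hc : b.coeff t = 0 := by
        have := coeff_of_mem_degreeLT hb' (le_refl (t + 2))
        rwa [← sub_eq_zero.mp hz, coeff_X_pow_mul] at this
      have := sub_leading_mem_degreeLT hb
      rw [hc, C_0, zero_mul, sub_zero] at this
      exact Submodule.add_mem_sup ha this
  obtain ⟨N0, hN0⟩ := claim1 k 0 (by omega)
  have claim2 : ∀ N, N0 ≤ N → ∀ f ∈ orthoLT u N, L f ∈ orthoLT u N := by
    intro N hN f hf
    obtain ⟨a, ha, b, hb, hab⟩ := Submodule.mem_sup.mp (hN0 N hN f hf)
    rw [← hab, eq_zero_of_mem_degreeLT_zero hb, add_zero]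
    exact ha
  clear claim1 hN0
  -- In the relation for `p (n + 2)`, the term `L (X² p (n + 2))` is isolated. Since `X² p (n + 2)`
  -- is a nonzero multiple of `p n` modulo `orthoLT u (n + 1)`, this controls `L (p n)`.
  have descent : ∀ n, (∀ N, n + 1 ≤ N → ∀ f ∈ orthoLT u N, L f ∈ orthoLT u N) →
      ∀ f ∈ orthoLT u n, L f ∈ orthoLT u n := by
    intro n hn
    have hp2 := hu.mem_orthoLT (n + 2)
    have hLp : L (p n) ∈ orthoLT u n := by
      have h1 := hn (n + 2) (by omega) _ hp2
      have h2 := hn (n + 1) (by omega) _ (hXV hp2)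
      have h3 := hX2V hp2
      have m0 : π * p (n + 2) ∈ orthoLT u n := mul_mem_orthoLT hπ (by rwa [add_comm])
      have m := Submodule.sub_mem _ (Submodule.add_mem _ (Submodule.add_mem _
        (Submodule.add_mem _ m0 (C_mul_mem_orthoLT c1 (hXV h2)))
        (C_mul_mem_orthoLT c2 (Submodule.add_mem _ (hXV (orthoLT_le u (by omega) h1))
          (orthoLT_le u (Nat.le_succ n) h2))))
        (C_mul_mem_orthoLT c3 (orthoLT_le u (by omega : n ≤ n + 2) h1))) (hX2V h1)
      rw [← hE, add_sub_cancel_left] at m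
      have hc : u (X ^ 2 * p (n + 2) * p n) ≠ 0 := by
        have hd : X ^ 2 * p n ∈ degreeLT ℂ (n + 2 + 1) := by
          have := mul_mem_degreeLT (X_pow_mem_degreeLT 2) (hu.mem_degreeLT n)
          rwa [show 2 + (n + 1) = n + 2 + 1 by ring] at this
        rw [show X ^ 2 * p (n + 2) * p n = p (n + 2) * (X ^ 2 * p n) by ring, hu.map_mul_eq hd,
          coeff_X_pow_mul]
        exact mul_ne_zero (div_ne_zero (hu.coeff_ne n) (hu.coeff_ne _)) (hu.norm_ne _)
      have h4 := hn (n + 1) le_rfl _ (hu.sub_mem_orthoLT h3)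
      have h5 := Submodule.sub_mem _ m (orthoLT_le u (Nat.le_succ n) h4)
      rw [← map_sub, sub_sub_cancel, map_C_mul] at h5
      have h6 := C_mul_mem_orthoLT (u (X ^ 2 * p (n + 2) * p n) / u (p n * p n))⁻¹ h5
      rwa [← mul_assoc, ← C_mul, inv_mul_cancel₀ (div_ne_zero hc (hu.norm_ne n)), C_1,
        one_mul] at h6
    intro f hf
    have h4 := hn (n + 1) le_rfl _ (hu.sub_mem_orthoLT hf)
    rw [← sub_add_cancel f (C (u (f * p n) / u (p n * p n)) * p n), map_add, map_C_mul]
    exact Submodule.add_mem _ (orthoLT_le u (Nat.le_succ n) h4) (C_mul_mem_orthoLT _ hLp)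
  have final : ∀ M, (∀ N, M ≤ N → ∀ f ∈ orthoLT u N, L f ∈ orthoLT u N) →
      ∀ N, ∀ f ∈ orthoLT u N, L f ∈ orthoLT u N := by
    intro M
    induction M with
    | zero => exact fun hM N => hM N (Nat.zero_le N)
    | succ M ih =>
      intro hM
      refine ih fun N hN => ?_
      rcases eq_or_lt_of_le hN with rfl | hN
      · exact descent M hM
      · exact hM N hN
  exact final N0 claim2

/-- A zero of the factor gives `p (n + 1)` in the kernel, hence `w` annihilates the ideal of `D (p
(n + 1))`. A `D`-preimage of `X` times that generator is then also in the kernel, so the next factor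
vanishes too, and two consecutive zeros force the operator to be 0. -/
theorem eigenFactor_ne_zero (h : IsDividedDifference α δ ε D)
    (hα : ∀ n, qNumber α (n + 1) ≠ 0) (hu : IsOrthogonalFor p u) (a0 a1 a2 b0 b1 : ℂ)
    (hp : ∀ n, secondOrder D (quad a0 a1 a2) (quad b0 b1 0) (p n) =
      C (eigenValue α a2 b1 n) * p n)
    (hL : secondOrder D (quad a0 a1 a2) (quad b0 b1 0) ≠ 0) (n : ℕ) :
    eigenFactor α a2 b1 (n + 1) ≠ 0 := by
  intro hn
  -- The constant has eigenvalue 0, and `u` kills `p i` for `i ≥ 1`. As `D` is surjective, this is a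
  -- Pearson equation for `u` itself.
  have huL : ∀ f, u (secondOrder D (quad a0 a1 a2) (quad b0 b1 0) f) = 0 := by
    intro f
    refine hu.degreeLT_induction
      (P := fun f => u (secondOrder D (quad a0 a1 a2) (quad b0 b1 0) f) = 0)
      (by simp) ?_ ?_ _ ?_ f (mem_degreeLT_natDegree f)
    · intro f g hf hg; rw [map_add, map_add, hf, hg, add_zero]
    · intro a f hf; rw [map_C_mul, map_C_mul', hf, mul_zero]
    · intro i _
      rw [hp, map_C_mul']
      cases i with
      | zero => simp [eigenValue, qNumber]
      | succ i =>
        have := hu.mem_orthoLT (i + 1) 1 (degreeLT_le (by omega)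
          (by simpa using X_pow_mem_degreeLT 0 : (1 : ℂ[X]) ∈ degreeLT ℂ 1))
        rw [mul_one] at this
        rw [this, mul_zero]
  obtain ⟨w, hw⟩ := h.exists_form_of_pearson (quad a0 a1 a2) (quad b0 b1 0) u (by
    intro f
    obtain ⟨g, rfl⟩ := h.surjective hα f
    exact huL g)
  have hzero : ∀ g, w (D (p (n + 1)) * g) = 0 := by
    intro g
    obtain ⟨g, rfl⟩ := h.surjective hα g
    rw [← hw, hp, eigenValue, hn, mul_zero, C_0, zero_mul, mul_zero, map_zero]
  obtain ⟨f, hf⟩ := h.surjective hα (D (p (n + 1)) * X)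
  have hLf : secondOrder D (quad a0 a1 a2) (quad b0 b1 0) f = 0 := by
    refine hu.eq_zero_of_mem _ _ (mem_degreeLT_natDegree _) fun g _ => ?_
    rw [mul_comm, hw, hf, mul_assoc, hzero]
  have hXm : (X : ℂ[X]) ∈ degreeLT ℂ (1 + 1) := by simpa using X_pow_mem_degreeLT 1
  have hDp := h.map_degreeLT _ _ (hu.mem_degreeLT (n + 1))
  have hcf := h.coeff_map n (hu.mem_degreeLT (n + 1))
  have hfd : f ∈ degreeLT ℂ (n + 2 + 1) := by
    apply h.mem_degreeLT_of_map hα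
    rw [hf, mul_comm, show n + 2 = 1 + (n + 1) by ring]
    exact mul_mem_degreeLT hXm hDp
  have hfc : f.coeff (n + 2) ≠ 0 := by
    intro h0
    have := h.coeff_map (n + 1) hfd
    rw [hf, h0, mul_zero, coeff_mul_X, hcf] at this
    exact mul_ne_zero (hα n) (hu.coeff_ne (n + 1)) this
  have h2 := h.coeff_secondOrder a0 a1 a2 b0 b1 (n + 2) hfd
  rw [hLf, coeff_zero] at h2
  have h3 := (mul_eq_zero.mp h2.symm).resolve_right hfc
  have h4 := (mul_eq_zero.mp h3).resolve_left (hα (n + 1))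
  obtain ⟨ha, hb⟩ := eq_zero_of_eigenFactor hn h4
  apply hL
  refine LinearMap.ext fun f => ?_
  refine hu.degreeLT_induction
    (P := fun f => secondOrder D (quad a0 a1 a2) (quad b0 b1 0) f = 0) (by simp) ?_ ?_ _ ?_ f (mem_degreeLT_natDegree f)
  · intro f g hf hg; rw [map_add, hf, hg]; simp
  · intro a f hf; rw [map_C_mul, hf]; simp
  · intro i _
    rw [hp]; simp [eigenValue, eigenFactor, ha, hb]

/-- If `D ^ (k + 1)` maps an orthogonal polynomial sequence to an orthogonal polynomial sequence,
then the sequence consists of eigenfunctions of a second order operator, with pairwise distinct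
eigenvalues. -/
theorem exists_secondOrder (h : IsDividedDifference α δ ε D)
    (hα : ∀ n, qNumber α (n + 1) ≠ 0) (hu : IsOrthogonalFor p u) (k : ℕ)
    (hv : IsOrthogonalFor (fun n => (D ^ (k + 1)) (p (n + (k + 1)))) v) :
    ∃ a0 a1 a2 b0 b1 : ℂ,
      (∀ n, secondOrder D (quad a0 a1 a2) (quad b0 b1 0) (p n) =
        C (eigenValue α a2 b1 n) * p n) ∧
      ∀ n, eigenFactor α a2 b1 (n + 1) ≠ 0 := by
  obtain ⟨φ, hφ, hpe⟩ := h.exists_pearson hα hu k hv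
  set Q : ℕ → ℂ[X] := fun n => (D ^ (k + 1)) (p (n + (k + 1))) with hQ
  have hQ1 : (D ^ (k + 1)) (p (1 + (k + 1))) = quad ((Q 1).coeff 0) ((Q 1).coeff 1) 0 := by
    have h1 := eq_quad_of_mem_degreeLT (degreeLT_le (by omega : 1 + 1 ≤ 3) (hv.mem_degreeLT 1))
    rwa [coeff_of_mem_degreeLT (hv.mem_degreeLT 1) le_rfl] at h1
  rw [hQ1, eq_quad_of_mem_degreeLT hφ] at hpe
  have hMv := fun n => h.secondOrder_mem_orthoLT_of_pearson _ _ _ _ _ hpe (hv.mem_orthoLT n)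
  have hMd := fun n => h.secondOrder_mem_degreeLT (φ.coeff 0) (φ.coeff 1) (φ.coeff 2)
    ((Q 1).coeff 0) ((Q 1).coeff 1) _ (hv.mem_degreeLT n)
  have hMQ := fun n => hv.eq_C_mul (hMd n) (hMv n)
  obtain ⟨a0, a1, a2, b0, b1, c, hlift⟩ := h.exists_lift_pow (k + 1) (φ.coeff 0) (φ.coeff 1)
    (φ.coeff 2) ((Q 1).coeff 0) ((Q 1).coeff 1)
  have hk : ∀ i, k + 1 ≤ i → secondOrder D (quad a0 a1 a2) (quad b0 b1 0) (p i) ∈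
      orthoLT u i ⊔ degreeLT ℂ (k + 1) := by
    intro i hi
    obtain ⟨m, rfl⟩ := Nat.exists_eq_add_of_le' hi
    obtain ⟨μ, hμ⟩ : ∃ μ, secondOrder D (quad (φ.coeff 0) (φ.coeff 1) (φ.coeff 2))
        (quad ((Q 1).coeff 0) ((Q 1).coeff 1) 0) (Q m) = C μ * Q m := ⟨_, hMQ m⟩
    have h1 : (D ^ (k + 1)) (secondOrder D (quad a0 a1 a2) (quad b0 b1 0) (p (m + (k + 1)))
        - C (μ + c) * p (m + (k + 1))) = 0 := by
      rw [map_sub, hlift, map_C_mul, show (D ^ (k + 1)) (p (m + (k + 1))) = Q m from rfl, hμ, C_add]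
      ring
    have h2 := h.mem_degreeLT_of_pow hα (k + 1) (n := 0) (by rw [h1]; exact Submodule.zero_mem _)
    rw [zero_add] at h2
    have := Submodule.add_mem_sup (C_mul_mem_orthoLT (μ + c) (hu.mem_orthoLT (m + (k + 1)))) h2
    rwa [add_sub_cancel] at this
  have hLo := h.secondOrder_mem_orthoLT hu a0 a1 a2 b0 b1 (k + 1) hk
  have hp : ∀ n, secondOrder D (quad a0 a1 a2) (quad b0 b1 0) (p n) =
      C (eigenValue α a2 b1 n) * p n := by
    intro n
    have := hu.eq_C_mul (h.secondOrder_mem_degreeLT a0 a1 a2 b0 b1 _ (hu.mem_degreeLT n))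
      (hLo n _ (hu.mem_orthoLT n))
    rwa [h.coeff_secondOrder _ _ _ _ _ _ (hu.mem_degreeLT n),
      mul_div_cancel_right₀ _ (hu.coeff_ne n)] at this
  refine ⟨a0, a1, a2, b0, b1, hp, h.eigenFactor_ne_zero hα hu a0 a1 a2 b0 b1 hp ?_⟩
  -- If the lift were 0, then `M = -c` by surjectivity of `D ^ (k + 1)`; testing on `1` gives `c =
  -- 0`, and on `X` gives `ψ = 0`, although `ψ = Q 1` has degree one.
  intro hL
  have hc : ∀ g, secondOrder D (quad (φ.coeff 0) (φ.coeff 1) (φ.coeff 2))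
      (quad ((Q 1).coeff 0) ((Q 1).coeff 1) 0) g + C c * g = 0 := by
    intro g
    obtain ⟨f, rfl⟩ := h.pow_surjective hα (k + 1) g
    rw [← hlift, hL, LinearMap.zero_apply, map_zero]
  have h1 := hc 1
  have h2 := hc X
  rw [secondOrder_apply, h.map_one] at h1
  rw [secondOrder_apply, h.map_X, h.map_one, mul_one, h.map_X] at h2
  simp only [map_zero, mul_zero, add_zero, zero_add, mul_one] at h1 h2
  rw [h1, zero_mul, add_zero] at h2
  exact hv.coeff_ne 1 (by
    have := congrArg (fun f => f.coeff 1) h2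
    simpa [quad, coeff_C] using this)

end IsDividedDifference

/-! ### Askey-Wilson polynomials as eigenfunctions. -/

theorem qPoch_succ (x q : ℂ) (k : ℕ) : qPoch x q (k + 1) = qPoch x q k * (1 - x * q ^ k) :=
  Finset.prod_range_succ _ _

theorem qPoch_succ' (x q : ℂ) (k : ℕ) : qPoch x q (k + 1) = (1 - x) * qPoch (x * q) q k := by
  rw [qPoch, Finset.prod_range_succ', mul_comm, pow_zero, mul_one, qPoch]
  congr 1
  refine Finset.prod_congr rfl fun i _ => ?_
  rw [pow_succ']; ring

/-- The polynomials `(a z, a / z; q)_k` in `X = (z + 1 / z) / 2`. -/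
noncomputable def awBasis (q a : ℂ) (k : ℕ) : ℂ[X] :=
  ∏ i ∈ Finset.range k, (1 - C (2 * a * q ^ i) * X + C (a ^ 2 * q ^ (2 * i)))

theorem awBasis_succ (q a : ℂ) (k : ℕ) : awBasis q a (k + 1) =
    awBasis q a k * (1 - C (2 * a * q ^ k) * X + C (a ^ 2 * q ^ (2 * k))) :=
  Finset.prod_range_succ _ _

theorem eval_awBasis (q a : ℂ) (k : ℕ) {z : ℂ} (hz : z ≠ 0) :
    (awBasis q a k).eval (joukowski z) = qPoch (a * z) q k * qPoch (a * z⁻¹) q k := by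
  rw [awBasis, eval_prod, qPoch, qPoch, ← Finset.prod_mul_distrib]
  refine Finset.prod_congr rfl fun i _ => ?_
  simp only [eval_add, eval_sub, eval_mul, eval_one, eval_C, eval_X, joukowski]
  field_simp
  ring

/-- The points `z² = 1` may be left out, since there `x₊ = x₋` and the difference quotient gives no
information. -/
theorem eq_of_eval_joukowski {f g : ℂ[X]}
    (h : ∀ z : ℂ, z ≠ 0 → z ^ 2 ≠ 1 → f.eval (joukowski z) = g.eval (joukowski z)) : f = g := by
  refine Polynomial.eq_of_infinite_eval_eq f g (Set.Infinite.mono (s := {1, -1}ᶜ) ?_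
    (Set.Finite.infinite_compl (by simp)))
  intro x hx
  obtain ⟨y, hy⟩ := IsAlgClosed.exists_pow_nat_eq (x ^ 2 - 1) (n := 2) (by norm_num)
  have hz : (x + y) * (x - y) = 1 := by linear_combination -hy
  have hz0 : x + y ≠ 0 := left_ne_zero_of_mul_eq_one hz
  have hj : joukowski (x + y) = x := by
    rw [joukowski, inv_eq_of_mul_eq_one_right hz]; ring
  have := h (x + y) hz0 (by
    intro h1
    have h2 : x - y = x + y := by
      apply mul_left_cancel₀ hz0; rw [hz, ← sq, h1]
    have h3 : y = 0 := by linear_combination -h2 / 2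
    rw [h3] at h1
    apply hx
    rw [add_zero, sq_eq_one_iff] at h1
    simpa using h1)
  rwa [hj] at this

section

variable {q : ℝ}

theorem sqrt_facts (hq : 0 < q) (hq1 : q < 1) : (Real.sqrt q : ℂ) ≠ 0 ∧
    (Real.sqrt q : ℂ) ^ 2 = (q : ℂ) ∧ (1 - (q : ℂ)) ≠ 0 := by
  refine ⟨by exact_mod_cast (Real.sqrt_pos.mpr hq).ne', by exact_mod_cast Real.sq_sqrt hq.le, ?_⟩
  have : 1 - q ≠ 0 := by linarith
  exact_mod_cast this

theorem joukowski_sub (s z : ℂ) (hs : s ≠ 0) (hz : z ≠ 0) :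
    joukowski (s * z) - joukowski (s⁻¹ * z) = (s ^ 2 - 1) * (z ^ 2 - 1) / (2 * s * z) := by
  simp only [joukowski]
  field_simp
  ring

theorem awOp_awBasis (hq : 0 < q) (hq1 : q < 1) (a : ℂ) (k : ℕ) :
    awOp q (awBasis q a (k + 1)) =
      C (-2 * a * (1 - q ^ (k + 1)) / (1 - q)) * awBasis q (a * Real.sqrt q) k := by
  obtain ⟨hs, hs2, h1q⟩ := sqrt_facts hq hq1
  refine eq_of_eval_joukowski fun z hz hz2 => ?_
  have hU := awOp_spec q hq (awBasis q a (k + 1)) z hz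
  set s : ℂ := (Real.sqrt q : ℂ)
  rw [← hs2] at h1q ⊢
  rw [← hs2] at hU
  have hne : joukowski (s * z) - joukowski (s⁻¹ * z) ≠ 0 := by
    rw [joukowski_sub s z hs hz]
    have : s ^ 2 - 1 ≠ 0 := by intro h; apply h1q; linear_combination -h
    exact div_ne_zero (mul_ne_zero this (sub_ne_zero.mpr hz2)) (mul_ne_zero (mul_ne_zero two_ne_zero hs) hz)
  apply mul_right_cancel₀ hne
  rw [hU, eval_awBasis _ _ _ (mul_ne_zero hs hz),
    eval_awBasis _ _ _ (mul_ne_zero (inv_ne_zero hs) hz), joukowski_sub s z hs hz, eval_mul, eval_C,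
    eval_awBasis _ _ _ hz, qPoch_succ (a * (s * z)), qPoch_succ' (a * (s * z)⁻¹),
    qPoch_succ' (a * (s⁻¹ * z)), qPoch_succ (a * (s⁻¹ * z)⁻¹)]
  rw [show a * (s * z)⁻¹ * s ^ 2 = a * s * z⁻¹ by field_simp,
    show a * (s⁻¹ * z) * s ^ 2 = a * s * z by field_simp,
    show a * (s⁻¹ * z)⁻¹ = a * s * z⁻¹ by field_simp, show a * (s * z) = a * s * z by ring,
    pow_succ (s ^ 2) k]
  generalize qPoch (a * s * z) (s ^ 2) k = A
  generalize qPoch (a * s * z⁻¹) (s ^ 2) k = B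
  generalize (s ^ 2) ^ k = Q
  field_simp
  ring

/-- With `g = 𝒟_q f`, the operator is `((Φ + Ψx₊) g(x₊) - (Φ + Ψx₋) g(x₋)) / (x₊ - x₋)`. The factor
`1 - az` of the symbol completes the shifted products to `(az, a/z; q)_k`, so the action is
bidiagonal on the basis. -/
theorem secondOrder_awBasis (hq : 0 < q) (hq1 : q < 1) {Φ Ψ : ℂ[X]} {κ a b c d : ℂ}
    (hN : ∀ z : ℂ, z ≠ 0 → Φ.eval (joukowski z) + Ψ.eval (joukowski z) *
      joukowski (Real.sqrt q * z) =
      κ * (z⁻¹) ^ 2 * ((1 - a * z) * (1 - b * z) * (1 - c * z) * (1 - d * z))) (k : ℕ) :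
    secondOrder (awOp q) Φ Ψ (awBasis q a (k + 1)) =
      C (-4 * κ * Real.sqrt q / (1 - q) ^ 2 * (1 - q ^ (k + 1)) / q ^ k) *
        (C ((1 - a * b * q ^ k) * (1 - a * c * q ^ k) * (1 - a * d * q ^ k)) * awBasis q a k
          - C (1 - a * b * c * d * q ^ k) * awBasis q a (k + 1)) := by
  obtain ⟨hs, hs2, h1q⟩ := sqrt_facts hq hq1
  rw [secondOrder_apply, awOp_awBasis hq hq1, mul_left_comm X, map_C_mul, map_C_mul]
  refine eq_of_eval_joukowski fun z hz hz2 => ?_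
  have hU := awOp_spec q hq (awBasis q (a * Real.sqrt q) k) z hz
  have hV := awOp_spec q hq (X * awBasis q (a * Real.sqrt q) k) z hz
  have hN1 := hN z hz
  -- Replacing `z` by its inverse fixes `x` and exchanges `x₊` with `x₋`.
  have hN2 := hN z⁻¹ (inv_ne_zero hz)
  set s : ℂ := (Real.sqrt q : ℂ)
  rw [← hs2] at h1q hU hV ⊢
  have hj1 : joukowski z⁻¹ = joukowski z := by simp [joukowski, add_comm]
  have hj2 : joukowski (s * z⁻¹) = joukowski (s⁻¹ * z) := by
    simp [joukowski, add_comm, mul_comm]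
  rw [hj1, hj2] at hN2
  have hne : joukowski (s * z) - joukowski (s⁻¹ * z) ≠ 0 := by
    rw [joukowski_sub s z hs hz]
    have : s ^ 2 - 1 ≠ 0 := by intro h; apply h1q; linear_combination -h
    exact div_ne_zero (mul_ne_zero this (sub_ne_zero.mpr hz2)) (mul_ne_zero (mul_ne_zero two_ne_zero hs) hz)
  apply mul_right_cancel₀ hne
  simp only [eval_mul, eval_X] at hV
  have eU : (awBasis (s ^ 2) (a * s) k).eval (joukowski (s * z)) =
      qPoch (a * z * s ^ 2) (s ^ 2) k * qPoch (a * z⁻¹) (s ^ 2) k := by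
    rw [eval_awBasis _ _ _ (mul_ne_zero hs hz), show a * s * (s * z)⁻¹ = a * z⁻¹ by field_simp,
      show a * s * (s * z) = a * z * s ^ 2 by ring]
  have eV : (awBasis (s ^ 2) (a * s) k).eval (joukowski (s⁻¹ * z)) =
      qPoch (a * z) (s ^ 2) k * qPoch (a * z⁻¹ * s ^ 2) (s ^ 2) k := by
    rw [eval_awBasis _ _ _ (mul_ne_zero (inv_ne_zero hs) hz),
      show a * s * (s⁻¹ * z) = a * z by field_simp,
      show a * s * (s⁻¹ * z)⁻¹ = a * z⁻¹ * s ^ 2 by field_simp]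
  -- Two factorisations of one product: `(1 - x)(xq; q)_k = (x; q)_k (1 - x q^k)`.
  have e1 := (qPoch_succ' (a * z) (s ^ 2) k).symm.trans (qPoch_succ (a * z) (s ^ 2) k)
  have e2 := (qPoch_succ' (a * z⁻¹) (s ^ 2) k).symm.trans (qPoch_succ (a * z⁻¹) (s ^ 2) k)
  rw [eU, eV] at hU hV
  have hrhs : (C (-4 * κ * s / (1 - s ^ 2) ^ 2 * (1 - (s ^ 2) ^ (k + 1)) / (s ^ 2) ^ k) *
        (C ((1 - a * b * (s ^ 2) ^ k) * (1 - a * c * (s ^ 2) ^ k) * (1 - a * d * (s ^ 2) ^ k))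
          * awBasis (s ^ 2) a k
          - C (1 - a * b * c * d * (s ^ 2) ^ k) * awBasis (s ^ 2) a (k + 1))).eval (joukowski z) =
      (-4 * κ * s / (1 - s ^ 2) ^ 2 * (1 - (s ^ 2) ^ (k + 1)) / (s ^ 2) ^ k) *
      (((1 - a * b * (s ^ 2) ^ k) * (1 - a * c * (s ^ 2) ^ k) * (1 - a * d * (s ^ 2) ^ k))
        - (1 - a * b * c * d * (s ^ 2) ^ k) * ((1 - a * z * (s ^ 2) ^ k)
          * (1 - a * z⁻¹ * (s ^ 2) ^ k))) * (qPoch (a * z) (s ^ 2) k *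
          qPoch (a * z⁻¹) (s ^ 2) k) := by
    rw [eval_mul, eval_C, eval_sub, eval_mul, eval_C, eval_mul, eval_C, eval_awBasis _ _ _ hz,
      eval_awBasis _ _ _ hz, qPoch_succ, qPoch_succ]
    ring
  rw [hrhs]
  have hlhs : (Φ * (C (-2 * a * (1 - (s ^ 2) ^ (k + 1)) / (1 - s ^ 2)) *
        awOp q (awBasis (s ^ 2) (a * s) k)) +
      Ψ * (C (-2 * a * (1 - (s ^ 2) ^ (k + 1)) / (1 - s ^ 2)) *
        awOp q (X * awBasis (s ^ 2) (a * s) k))).eval (joukowski z) *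
      (joukowski (s * z) - joukowski (s⁻¹ * z)) =
      (-2 * a * (1 - (s ^ 2) ^ (k + 1)) / (1 - s ^ 2)) * κ * ((z⁻¹) ^ 2 * ((1 - b * z) *
        (1 - c * z) * (1 - d * z) * (1 - a * z * (s ^ 2) ^ k)) - (z ^ 2 * ((1 - b * z⁻¹) *
        (1 - c * z⁻¹) * (1 - d * z⁻¹) * (1 - a * z⁻¹ * (s ^ 2) ^ k)))) *
        (qPoch (a * z) (s ^ 2) k * qPoch (a * z⁻¹) (s ^ 2) k) := by
    simp only [eval_add, eval_mul, eval_C]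
    rw [inv_inv] at hN2
    generalize joukowski (s * z) = U at *
    generalize joukowski (s⁻¹ * z) = V at *
    generalize qPoch (a * z) (s ^ 2) k = A at *
    generalize qPoch (a * z⁻¹) (s ^ 2) k = B at *
    generalize qPoch (a * z * s ^ 2) (s ^ 2) k = A' at *
    generalize qPoch (a * z⁻¹ * s ^ 2) (s ^ 2) k = B' at *
    generalize -2 * a * (1 - (s ^ 2) ^ (k + 1)) / (1 - s ^ 2) = m at *
    generalize (s ^ 2) ^ k = Q at *
    linear_combination m * Φ.eval (joukowski z) * hU + m * Ψ.eval (joukowski z) * hV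
      + m * A' * B * hN1 - m * A * B' * hN2
      + m * κ * (z⁻¹) ^ 2 * ((1 - b * z) * (1 - c * z) * (1 - d * z)) * B * e1
      - m * κ * z ^ 2 * ((1 - b * z⁻¹) * (1 - c * z⁻¹) * (1 - d * z⁻¹)) * A * e2
  rw [hlhs, joukowski_sub s z hs hz, pow_succ (s ^ 2) k]
  have hQ : (s ^ 2) ^ k ≠ 0 := pow_ne_zero _ (pow_ne_zero _ hs)
  generalize qPoch (a * z) (s ^ 2) k = A
  generalize qPoch (a * z⁻¹) (s ^ 2) k = B
  generalize (s ^ 2) ^ k = Q at *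
  field_simp
  ring

end

/-- The coefficients of the Askey-Wilson polynomials with respect to `awBasis`, up to `a⁻ⁿ`. -/
noncomputable def awCoeff (q a b c d : ℂ) (n k : ℕ) : ℂ :=
  qPoch (q ^ n)⁻¹ q k * qPoch (a * b * c * d * q ^ n / q) q k / qPoch q q k * q ^ k *
    (qPoch (a * b * q ^ k) q (n - k) * qPoch (a * c * q ^ k) q (n - k) *
      qPoch (a * d * q ^ k) q (n - k))

theorem awPoly_eq (q a b c d : ℂ) (n : ℕ) : awPoly q a b c d n =
    C (a ^ n)⁻¹ * ∑ k ∈ Finset.range (n + 1), C (awCoeff q a b c d n k) * awBasis q a k := rfl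

theorem qPoch_self_ne_zero {q : ℝ} (hq : 0 < q) (hq1 : q < 1) (k : ℕ) : qPoch (q : ℂ) q k ≠ 0 := by
  refine Finset.prod_ne_zero_iff.mpr fun i _ => ?_
  have : 1 - q * q ^ i ≠ 0 := by
    have h1 : q ^ i ≤ 1 := pow_le_one₀ hq.le hq1.le
    nlinarith
  exact_mod_cast this

theorem awCoeff_succ {q : ℝ} (hq : 0 < q) (hq1 : q < 1) (a b c d : ℂ) {n k : ℕ} (hk : k < n) :
    awCoeff q a b c d n (k + 1) * (1 - (q : ℂ) ^ (k + 1)) *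
      ((1 - a * b * q ^ k) * (1 - a * c * q ^ k) * (1 - a * d * q ^ k)) =
    awCoeff q a b c d n k * q * (1 - q ^ k / q ^ n) * (1 - a * b * c * d * q ^ n / q * q ^ k) := by
  obtain ⟨m, rfl⟩ : ∃ m, n = k + m + 1 := ⟨n - k - 1, by omega⟩
  have h1 := qPoch_self_ne_zero hq hq1 (k + 1)
  have h0 := qPoch_self_ne_zero hq hq1 k
  rw [qPoch_succ] at h1
  have h2 := right_ne_zero_of_mul h1
  rw [← pow_succ'] at h2
  simp only [awCoeff]
  rw [show k + m + 1 - (k + 1) = m by omega, show k + m + 1 - k = m + 1 by omega, qPoch_succ,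
    qPoch_succ _ _ k, qPoch_succ (q : ℂ) q k, qPoch_succ' (a * b * (q : ℂ) ^ k),
    qPoch_succ' (a * c * (q : ℂ) ^ k), qPoch_succ' (a * d * (q : ℂ) ^ k), ← pow_succ' (q : ℂ) k]
  have e : ∀ x : ℂ, x * (q : ℂ) ^ k * q = x * q ^ (k + 1) := fun x => by ring
  rw [e (a * b), e (a * c), e (a * d), div_eq_inv_mul ((q : ℂ) ^ k)]
  field_simp
  ring

theorem awOp_monomial (q : ℝ) (n : ℕ) (a : ℂ) : awOp q (monomial n a) = a • awMonomial q n := by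
  simp [awOp]

theorem awOp_one (q : ℝ) : awOp q 1 = 0 := by
  rw [← monomial_zero_one, awOp_monomial, awMonomial, smul_zero]

theorem eigen_of_bidiagonal (T : Module.End ℂ ℂ[X]) (φ : ℕ → ℂ[X]) (t x y : ℕ → ℂ) (n : ℕ)
    (hstep : ∀ k, T (φ (k + 1)) = C (x (k + 1)) * φ (k + 1) + C (y k) * φ k)
    (hzero : T (φ 0) = C (x 0) * φ 0)
    (hrec : ∀ k < n, t k * x k + t (k + 1) * y k = x n * t k) :
    T (∑ k ∈ Finset.range (n + 1), C (t k) * φ k) =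
      C (x n) * ∑ k ∈ Finset.range (n + 1), C (t k) * φ k := by
  rw [map_sum, Finset.sum_range_succ']
  simp only [map_C_mul]
  have e1 : ∑ k ∈ Finset.range n, C (t (k + 1)) * T (φ (k + 1)) + C (t 0) * T (φ 0) =
      ∑ k ∈ Finset.range (n + 1), C (t k * x k) * φ k +
        ∑ k ∈ Finset.range n, C (t (k + 1) * y k) * φ k := by
    rw [Finset.sum_range_succ' (fun k => C (t k * x k) * φ k), hzero, add_right_comm,
      ← Finset.sum_add_distrib]
    congr 1
    · refine Finset.sum_congr rfl fun k _ => ?_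
      rw [hstep, C_mul, C_mul]; ring
    · rw [C_mul]; ring
  rw [e1, Finset.sum_range_succ, add_right_comm, ← Finset.sum_add_distrib, Finset.mul_sum,
    Finset.sum_range_succ (fun i => C (x n) * (C (t i) * φ i))]
  congr 1
  · refine Finset.sum_congr rfl fun k hk => ?_
    rw [← add_mul, ← C_add, hrec k (Finset.mem_range.mp hk), C_mul, mul_assoc]
  · rw [C_mul]; ring

/-- The ratio of consecutive `₄φ₃` coefficients is exactly the two-term recurrence that a bidiagonal
operator imposes on an eigenvector. -/
theorem secondOrder_awPoly {q : ℝ} (hq : 0 < q) (hq1 : q < 1) {Φ Ψ : ℂ[X]} {κ a b c d : ℂ}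
    (hN : ∀ z : ℂ, z ≠ 0 → Φ.eval (joukowski z) + Ψ.eval (joukowski z) *
      joukowski (Real.sqrt q * z) =
      κ * (z⁻¹) ^ 2 * ((1 - a * z) * (1 - b * z) * (1 - c * z) * (1 - d * z))) (n : ℕ) :
    ∃ μ : ℂ, secondOrder (awOp q) Φ Ψ (awPoly q a b c d n) = C μ * awPoly q a b c d n := by
  have hqc : (q : ℂ) ≠ 0 := by exact_mod_cast hq.ne'
  obtain ⟨ω, hω⟩ : ∃ ω : ℂ, ω = -4 * κ * Real.sqrt q / (1 - q) ^ 2 := ⟨_, rfl⟩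
  refine ⟨-ω * (1 - q ^ n) * (q / q ^ n) * (1 - a * b * c * d * q ^ n / q), ?_⟩
  rw [awPoly_eq, map_C_mul, mul_left_comm]
  congr 1
  refine eigen_of_bidiagonal _ (awBasis (q : ℂ) a) (awCoeff q a b c d n)
    (fun k => -ω * (1 - q ^ k) * (q / q ^ k) * (1 - a * b * c * d * q ^ k / q))
    (fun k => ω * (1 - q ^ (k + 1)) / q ^ k *
      ((1 - a * b * q ^ k) * (1 - a * c * q ^ k) * (1 - a * d * q ^ k))) n ?_ ?_ ?_
  · intro k
    have hx : -ω * (1 - (q : ℂ) ^ (k + 1)) * (q / q ^ (k + 1)) *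
          (1 - a * b * c * d * q ^ (k + 1) / q) =
        -(ω * (1 - q ^ (k + 1)) / q ^ k * (1 - a * b * c * d * q ^ k)) := by
      have hQ : (q : ℂ) ^ k ≠ 0 := pow_ne_zero _ hqc
      rw [pow_succ]
      generalize (q : ℂ) ^ k = Q at *
      field_simp
    rw [secondOrder_awBasis hq hq1 hN, hx, ← hω]
    simp only [C_neg, C_mul]
    ring
  · simp [awBasis, secondOrder_apply, awOp_one]
  · intro k hk
    have h1 := awCoeff_succ hq hq1 a b c d hk
    have h2 : awCoeff q a b c d n (k + 1) * (ω * (1 - (q : ℂ) ^ (k + 1)) / q ^ k *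
        ((1 - a * b * q ^ k) * (1 - a * c * q ^ k) * (1 - a * d * q ^ k))) =
        ω / q ^ k * (awCoeff q a b c d n k * q * (1 - q ^ k / q ^ n) *
        (1 - a * b * c * d * q ^ n / q * q ^ k)) := by
      linear_combination ω / q ^ k * h1
    rw [h2]
    have hQ : (q : ℂ) ^ k ≠ 0 := pow_ne_zero _ hqc
    have hR : (q : ℂ) ^ n ≠ 0 := pow_ne_zero _ hqc
    generalize (q : ℂ) ^ k = Q at *
    generalize (q : ℂ) ^ n = R at *
    generalize awCoeff q a b c d n k = t
    field_simp
    ring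

theorem awBasis_top (q a : ℂ) (k : ℕ) : awBasis q a k ∈ degreeLT ℂ (k + 1) ∧
    (awBasis q a k).coeff k = ∏ i ∈ Finset.range k, (-(2 * a * q ^ i)) := by
  induction k with
  | zero =>
    have := X_pow_mem_degreeLT 0
    simpa [awBasis] using this
  | succ k ih =>
    have e : (1 - C (2 * a * q ^ k) * X + C (a ^ 2 * q ^ (2 * k)) : ℂ[X]) =
        C (1 + a ^ 2 * q ^ (2 * k)) + C (-(2 * a * q ^ k)) * X := by
      simp only [C_add, C_neg, C_1]; ring
    have hl := linear_mem_degreeLT (1 + a ^ 2 * q ^ (2 * k)) (-(2 * a * q ^ k))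
    have h1 := mul_mem_degreeLT ih.1 hl
    have h2 := coeff_mul_top ih.1 hl
    rw [awBasis_succ, e]
    refine ⟨h1, ?_⟩
    rw [h2, Finset.prod_range_succ, ih.2, coeff_add, coeff_C_mul, coeff_X_one, coeff_C,
      if_neg one_ne_zero, zero_add, mul_one]

theorem awPoly_mem_degreeLT (q a b c d : ℂ) (n : ℕ) : awPoly q a b c d n ∈ degreeLT ℂ (n + 1) := by
  rw [awPoly_eq]
  refine C_mul_mem_degreeLT _ (Submodule.sum_mem _ fun k hk => C_mul_mem_degreeLT _ ?_)
  exact degreeLT_le (by have := Finset.mem_range.mp hk; omega) (awBasis_top q a k).1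

theorem coeff_awPoly_ne_zero {q : ℝ} (hq : 0 < q) (hq1 : q < 1) {a b c d : ℂ} (ha : a ≠ 0) {n : ℕ}
    (h : ∀ i < n, a * b * c * d * (q : ℂ) ^ (n + i) ≠ q) : (awPoly q a b c d n).coeff n ≠ 0 := by
  have hqc : (q : ℂ) ≠ 0 := by exact_mod_cast hq.ne'
  rw [awPoly_eq, coeff_C_mul, finsetSum_coeff, Finset.sum_range_succ, Finset.sum_eq_zero, zero_add,
    coeff_C_mul, (awBasis_top _ _ _).2, awCoeff, Nat.sub_self]
  · simp only [qPoch, Finset.range_zero, Finset.prod_empty, mul_one]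
    refine mul_ne_zero (inv_ne_zero (pow_ne_zero _ ha)) (mul_ne_zero (mul_ne_zero (div_ne_zero
      (mul_ne_zero ?_ ?_) (qPoch_self_ne_zero hq hq1 n)) (pow_ne_zero _ hqc)) ?_)
    · refine Finset.prod_ne_zero_iff.mpr fun i hi => ?_
      have hi := Finset.mem_range.mp hi
      obtain ⟨m, rfl⟩ : ∃ m, n = i + (m + 1) := ⟨n - i - 1, by omega⟩
      have : 1 - (q ^ (m + 1))⁻¹ ≠ 0 := by
        have h1 : q ^ (m + 1) < 1 := pow_lt_one₀ hq.le hq1 (by omega)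
        have h2 : 1 < (q ^ (m + 1))⁻¹ := (one_lt_inv₀ (by positivity)).mpr h1
        linarith
      have h3 : (1 : ℂ) - ((q : ℂ) ^ (i + (m + 1)))⁻¹ * q ^ i = 1 - ((q : ℂ) ^ (m + 1))⁻¹ := by
        rw [pow_add]; field_simp
      rw [h3]
      exact_mod_cast this
    · refine Finset.prod_ne_zero_iff.mpr fun i hi h0 => h i (Finset.mem_range.mp hi) ?_
      rw [pow_add]
      field_simp at h0
      linear_combination -h0
    · refine Finset.prod_ne_zero_iff.mpr fun i _ => ?_
      exact neg_ne_zero.mpr (mul_ne_zero (mul_ne_zero two_ne_zero ha) (pow_ne_zero _ hqc))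
  · intro k hk
    rw [coeff_C_mul, coeff_of_mem_degreeLT (awBasis_top _ _ k).1 (Finset.mem_range.mp hk), mul_zero]

/-! ### Recovering the four parameters from the operator. -/

theorem exists_elementary_symmetric (e1 e2 e3 e4 : ℂ) : ∃ a b c d : ℂ, a + b + c + d = e1 ∧
    a * b + a * c + a * d + b * c + b * d + c * d = e2 ∧
    a * b * c + a * b * d + a * c * d + b * c * d = e3 ∧ a * b * c * d = e4 := by
  have root : ∀ (n : ℕ) (f : ℂ[X]), f ∈ degreeLT ℂ (n + 1) → ∃ x, x ^ (n + 1) + f.eval x = 0 := by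
    intro n f hf
    have hd := mem_degreeLT.mp hf
    have hdeg : (X ^ (n + 1) + f).degree = ((n + 1 : ℕ) : WithBot ℕ) := by
      rw [degree_add_eq_left_of_degree_lt] <;> rw [degree_X_pow]
      exact hd
    obtain ⟨x, hx⟩ := IsAlgClosed.exists_root (X ^ (n + 1) + f) (by
      rw [hdeg]; exact_mod_cast Nat.succ_ne_zero n)
    exact ⟨x, by simpa [IsRoot] using hx⟩
  obtain ⟨a, ha⟩ := root 3 (C (-e1) * X ^ 3 + quad e4 (-e3) e2) (Submodule.add_mem _
    (C_mul_mem_degreeLT _ (X_pow_mem_degreeLT 3)) (degreeLT_le (by omega) (quad_mem_degreeLT _ _ _)))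
  obtain ⟨b, hb⟩ := root 2 (quad (-(e3 - a * (e2 - a * (e1 - a)))) (e2 - a * (e1 - a)) (-(e1 - a)))
    (quad_mem_degreeLT _ _ _)
  obtain ⟨c, hc⟩ := root 1 (C (e2 - a * (e1 - a) - b * (e1 - a - b)) + C (-(e1 - a - b)) * X)
    (linear_mem_degreeLT _ _)
  simp [quad] at ha hb hc
  refine ⟨a, b, c, e1 - a - b - c, by ring, ?_, ?_, ?_⟩
  · linear_combination -hc
  · linear_combination hb - (a + b) * hc
  · linear_combination -ha + a * hb - a * b * hc

/-- After multiplication by `z²` the symbol is a quartic in `z`. Its constant term is `κ`, nonzero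
by `h1`; its top coefficient is `κabcd`, nonzero by `h2`, which gives `a ≠ 0`. -/
theorem exists_parameters {q : ℝ} (hq : 0 < q) (A0 A1 A2 B0 B1 : ℂ)
    (h1 : A2 * Real.sqrt q + B1 ≠ 0) (h2 : A2 + B1 * Real.sqrt q ≠ 0) :
    ∃ κ a b c d : ℂ, a ≠ 0 ∧
      a * b * c * d * (A2 * Real.sqrt q + B1) = (A2 + B1 * Real.sqrt q) * Real.sqrt q ∧
      ∀ z : ℂ, z ≠ 0 → (quad A0 A1 A2).eval (joukowski z) + (quad B0 B1 0).eval (joukowski z) *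
        joukowski (Real.sqrt q * z) =
        κ * (z⁻¹) ^ 2 * ((1 - a * z) * (1 - b * z) * (1 - c * z) * (1 - d * z)) := by
  have hs : (Real.sqrt q : ℂ) ≠ 0 := by exact_mod_cast (Real.sqrt_pos.mpr hq).ne'
  generalize (Real.sqrt q : ℂ) = s at *
  obtain ⟨κ, hκ⟩ : ∃ κ, κ = (A2 * s + B1) / (4 * s) := ⟨_, rfl⟩
  have hκ0 : κ ≠ 0 := by rw [hκ]; exact div_ne_zero h1 (mul_ne_zero (by norm_num) hs)
  obtain ⟨a, b, c, d, he1, he2, he3, he4⟩ := exists_elementary_symmetric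
    (-(A1 / 2 + B0 / (2 * s)) / κ) ((A0 + A2 / 2 + B1 * (s + 1 / s) / 4) / κ)
    (-(A1 / 2 + B0 * s / 2) / κ) ((A2 + B1 * s) / 4 / κ)
  rw [eq_div_iff hκ0] at he1 he2 he3 he4
  refine ⟨κ, a, b, c, d, ?_, ?_, ?_⟩
  · rintro rfl
    apply h2
    linear_combination -4 * he4
  · rw [hκ] at he4
    field_simp at he4
    linear_combination he4
  · intro z hz
    have e : κ * (z⁻¹) ^ 2 * ((1 - a * z) * (1 - b * z) * (1 - c * z) * (1 - d * z)) =
        κ * (z⁻¹) ^ 2 - (a + b + c + d) * κ * z⁻¹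
        + (a * b + a * c + a * d + b * c + b * d + c * d) * κ
        - (a * b * c + a * b * d + a * c * d + b * c * d) * κ * z + a * b * c * d * κ * z ^ 2 := by
      field_simp
      ring
    rw [e, he1, he2, he3, he4, hκ]
    simp only [quad, eval_add, eval_mul, eval_C, eval_X, eval_pow, joukowski]
    field_simp
    ring

/-! ### Coefficientwise limits. -/

namespace CoeffTendsto

variable {f g : ℕ → ℂ[X]} {F G : ℂ[X]}

theorem add (hf : CoeffTendsto f F) (hg : CoeffTendsto g G) :
    CoeffTendsto (fun j => f j + g j) (F + G) := fun i => by
  simpa only [coeff_add] using (hf i).add (hg i)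

theorem sub (hf : CoeffTendsto f F) (hg : CoeffTendsto g G) :
    CoeffTendsto (fun j => f j - g j) (F - G) := fun i => by
  simpa only [coeff_sub] using (hf i).sub (hg i)

theorem mul (hf : CoeffTendsto f F) (hg : CoeffTendsto g G) :
    CoeffTendsto (fun j => f j * g j) (F * G) := fun i => by
  simp only [coeff_mul]
  exact tendsto_finsetSum _ fun x _ => (hf x.1).mul (hg x.2)

theorem const (F : ℂ[X]) : CoeffTendsto (fun _ => F) F := fun _ => tendsto_const_nhds

theorem C {c : ℕ → ℂ} {c' : ℂ} (h : Tendsto c atTop (𝓝 c')) :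
    CoeffTendsto (fun j => Polynomial.C (c j)) (Polynomial.C c') := fun i => by
  simp only [coeff_C]
  split_ifs
  · exact h
  · exact tendsto_const_nhds

theorem sum {ι : Type*} (s : Finset ι) {f : ι → ℕ → ℂ[X]} {F : ι → ℂ[X]}
    (h : ∀ i ∈ s, CoeffTendsto (f i) (F i)) :
    CoeffTendsto (fun j => ∑ i ∈ s, f i j) (∑ i ∈ s, F i) := fun n => by
  simp only [finsetSum_coeff]
  exact tendsto_finsetSum _ fun i hi => h i hi n

theorem unique (hf : CoeffTendsto f F) (hg : CoeffTendsto f G) : F = G :=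
  Polynomial.ext fun i => tendsto_nhds_unique (hf i) (hg i)

theorem congr' (hf : CoeffTendsto f F) (h : ∀ᶠ j in atTop, f j = g j) : CoeffTendsto g F :=
  fun i => (hf i).congr' (h.mono fun j hj => by rw [hj])

theorem mem_degreeLT (hf : CoeffTendsto f F) {n : ℕ} (h : ∀ j, f j ∈ degreeLT ℂ n) :
    F ∈ degreeLT ℂ n := by
  rw [Polynomial.mem_degreeLT, degree_lt_iff_coeff_zero]
  intro m hm
  refine tendsto_nhds_unique (hf m) ?_
  simp only [fun j => coeff_of_mem_degreeLT (h j) hm]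
  exact tendsto_const_nhds

theorem quad {a0 a1 a2 : ℕ → ℂ} {b0 b1 b2 : ℂ} (h0 : Tendsto a0 atTop (𝓝 b0))
    (h1 : Tendsto a1 atTop (𝓝 b1)) (h2 : Tendsto a2 atTop (𝓝 b2)) :
    CoeffTendsto (fun j => _root_.quad (a0 j) (a1 j) (a2 j)) (_root_.quad b0 b1 b2) :=
  ((C h0).add ((C h1).mul (const _))).add ((C h2).mul (const _))

/-- Bounded degree reduces the claim to finitely many monomials. -/
theorem map {A : ℕ → Module.End ℂ ℂ[X]} {B : Module.End ℂ ℂ[X]}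
    (hA : ∀ f, CoeffTendsto (fun j => A j f) (B f)) (hf : CoeffTendsto f F) {n : ℕ}
    (hn : ∀ j, f j ∈ degreeLT ℂ n) : CoeffTendsto (fun j => A j (f j)) (B F) := by
  have e : ∀ f ∈ degreeLT ℂ n, f = ∑ i ∈ Finset.range n, Polynomial.C (f.coeff i) * X ^ i := by
    intro f hf
    ext m
    simp only [finsetSum_coeff, coeff_C_mul_X_pow]
    rw [Finset.sum_ite_eq]
    split_ifs with hm
    · rfl
    · exact coeff_of_mem_degreeLT hf (by simpa using hm)
  have e1 : ∀ j, A j (f j) = ∑ i ∈ Finset.range n, Polynomial.C ((f j).coeff i) * A j (X ^ i) := by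
    intro j
    conv_lhs => rw [e _ (hn j)]
    simp only [map_sum, map_C_mul]
  have e2 : B F = ∑ i ∈ Finset.range n, Polynomial.C (F.coeff i) * B (X ^ i) := by
    conv_lhs => rw [e _ (hf.mem_degreeLT hn)]
    simp only [map_sum, map_C_mul]
  rw [e2]
  simp only [e1]
  exact sum _ fun i _ => (C (hf i)).mul (hA _)

end CoeffTendsto

/-! ### Eigenfunctions as continuous functions of a triangular operator. -/

/-- The product of `L - lam m` over `m < n`. -/
noncomputable def eigenProd (L : Module.End ℂ ℂ[X]) (lam : ℕ → ℂ) : ℕ → Module.End ℂ ℂ[X]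
  | 0 => 1
  | n + 1 => eigenProd L lam n * (L - lam n • 1)

theorem eigenProd_succ_apply (L : Module.End ℂ ℂ[X]) (lam : ℕ → ℂ) (n : ℕ) (f : ℂ[X]) :
    eigenProd L lam (n + 1) f = eigenProd L lam n (L f - C (lam n) * f) := by
  simp [eigenProd, smul_eq_C_mul]

/-- `L` acts triangularly with diagonal entries `lam n`. -/
def IsTriangular (L : Module.End ℂ ℂ[X]) (lam : ℕ → ℂ) : Prop :=
  ∀ n, ∀ f ∈ degreeLT ℂ (n + 1), L f ∈ degreeLT ℂ (n + 1) ∧ (L f).coeff n = lam n * f.coeff n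

namespace IsTriangular

variable {L : Module.End ℂ ℂ[X]} {lam : ℕ → ℂ}

theorem eigenProd_eq_zero (h : IsTriangular L lam) (n : ℕ) :
    ∀ f ∈ degreeLT ℂ n, eigenProd L lam n f = 0 := by
  induction n with
  | zero => intro f hf; rw [eq_zero_of_mem_degreeLT_zero hf, map_zero]
  | succ n ih =>
    intro f hf
    rw [eigenProd_succ_apply]
    refine ih _ (sub_mem_degreeLT (h n f hf).1 (C_mul_mem_degreeLT _ hf) ?_)
    rw [coeff_C_mul, (h n f hf).2]

theorem eigenProd_eigen {f : ℂ[X]} {μ : ℂ} (hf : L f = C μ * f) (n : ℕ) :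
    eigenProd L lam n f = C (∏ m ∈ Finset.range n, (μ - lam m)) * f := by
  induction n with
  | zero => simp [eigenProd]
  | succ n ih =>
    rw [eigenProd_succ_apply, hf, ← sub_mul, ← C_sub, map_C_mul, ih, Finset.prod_range_succ, C_mul]
    ring

/-- The product over `m < n` kills everything of degree below `n`, so an eigenfunction of degree `n`
and its leading term have the same image. -/
theorem eigen_eq (h : IsTriangular L lam) {n : ℕ} {f : ℂ[X]} (hf : f ∈ degreeLT ℂ (n + 1))
    {μ : ℂ} (hL : L f = C μ * f) (hc : f.coeff n ≠ 0) :
    C (∏ m ∈ Finset.range n, (lam n - lam m)) * f = C (f.coeff n) * eigenProd L lam n (X ^ n) := by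
  have hμ : μ = lam n := by
    have := (h n f hf).2
    rw [hL, coeff_C_mul] at this
    exact mul_right_cancel₀ hc this
  subst hμ
  have := h.eigenProd_eq_zero n _ (sub_leading_mem_degreeLT hf)
  rwa [map_sub, map_C_mul, eigenProd_eigen hL, sub_eq_zero] at this

theorem mem_degreeLT (h : IsTriangular L lam) (d : ℕ) {f : ℂ[X]} (hf : f ∈ degreeLT ℂ d) :
    L f ∈ degreeLT ℂ d := by
  cases d with
  | zero => rw [eq_zero_of_mem_degreeLT_zero hf, map_zero]; exact Submodule.zero_mem _
  | succ d => exact (h d f hf).1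

end IsTriangular

theorem eigenProd_tendsto {L : ℕ → Module.End ℂ ℂ[X]} {M : Module.End ℂ ℂ[X]}
    {lam : ℕ → ℕ → ℂ} {mu : ℕ → ℂ} (hL : ∀ f, CoeffTendsto (fun j => L j f) (M f))
    (hT : ∀ j, IsTriangular (L j) (lam j)) (hlam : ∀ n, Tendsto (fun j => lam j n) atTop (𝓝 (mu n)))
    (n d : ℕ) : ∀ {f : ℕ → ℂ[X]} {F : ℂ[X]}, CoeffTendsto f F → (∀ j, f j ∈ degreeLT ℂ d) →
      CoeffTendsto (fun j => eigenProd (L j) (lam j) n (f j)) (eigenProd M mu n F) := by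
  induction n with
  | zero => intro f F hf _; exact hf
  | succ n ih =>
    intro f F hf hd
    simp only [eigenProd_succ_apply]
    exact ih ((CoeffTendsto.map hL hf hd).sub ((CoeffTendsto.C (hlam n)).mul hf))
      fun j => Submodule.sub_mem _ ((hT j).mem_degreeLT d (hd j)) (C_mul_mem_degreeLT _ (hd j))

theorem tendsto_qNumber {a : ℕ → ℂ} {A : ℂ} (h : Tendsto a atTop (𝓝 A)) (n : ℕ) :
    Tendsto (fun j => qNumber (a j) n) atTop (𝓝 (qNumber A n)) := by
  induction n using Nat.twoStepInduction with
  | zero => exact tendsto_const_nhds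
  | one => exact tendsto_const_nhds
  | more n h1 h2 => exact ((h.const_mul 2).mul h2).sub h1

theorem IsDividedDifference.isTriangular {α δ ε : ℂ} {D : Module.End ℂ ℂ[X]}
    (h : IsDividedDifference α δ ε D) (a0 a1 a2 b0 b1 : ℂ) :
    IsTriangular (secondOrder D (quad a0 a1 a2) (quad b0 b1 0)) (eigenValue α a2 b1) :=
  fun n _ hf => ⟨h.secondOrder_mem_degreeLT a0 a1 a2 b0 b1 _ hf,
    h.coeff_secondOrder a0 a1 a2 b0 b1 n hf⟩

/-! ### The Askey-Wilson operator in an affine variable. -/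

theorem isDividedDifference_awOp (q : ℝ) :
    IsDividedDifference (awAlpha q) 0 (awAlpha q ^ 2 - 1) (awOp q) where
  map_one := awOp_one q
  map_X := by rw [← monomial_one_one_eq_X, awOp_monomial, awMonomial, one_smul]
  rel f := by
    induction f using Polynomial.induction_on' with
    | add f g hf hg => simp only [mul_add, map_add, hf, hg]; ring
    | monomial n a =>
      rw [X_pow_mul_monomial, X_mul_monomial, awOp_monomial, awOp_monomial, awOp_monomial,
        awMonomial]
      simp only [smul_eq_C_mul, C_mul, C_0, map_ofNat]
      ring

/-- The operator `𝒟_q` read in the variable `y = α x + β` and normalised to map `y` to `1`. -/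
noncomputable def normOp (q : ℝ) (α β : ℂ) : Module.End ℂ ℂ[X] :=
  α⁻¹ • ((aeval (C α⁻¹ * (X - C β))).toLinearMap ∘ₗ awOp q ∘ₗ (aeval (C α * X + C β)).toLinearMap)

theorem normOp_apply (q : ℝ) (α β : ℂ) (f : ℂ[X]) :
    normOp q α β f = C α⁻¹ * awOpAffine q α β f := by
  simp [normOp, awOpAffine, affineChange, comp_eq_aeval, smul_eq_C_mul]

theorem affineChange_comp {α : ℂ} (hα : α ≠ 0) (β : ℂ) (f : ℂ[X]) :
    (affineChange α β f).comp (C α * X + C β) = f := by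
  rw [affineChange, comp_assoc]
  have : (C α⁻¹ * (X - C β)).comp (C α * X + C β) = X := by
    simp only [mul_comp, sub_comp, C_comp, X_comp, add_sub_cancel_right]
    rw [← mul_assoc, ← C_mul, inv_mul_cancel₀ hα, C_1, one_mul]
  rw [this, comp_X]

theorem affineChange_X {α : ℂ} (hα : α ≠ 0) (β : ℂ) :
    C α * affineChange α β X = X - C β := by
  rw [affineChange, X_comp, ← mul_assoc, ← C_mul, mul_inv_cancel₀ hα, C_1, one_mul]

theorem affineChange_mul (α β : ℂ) (f g : ℂ[X]) :
    affineChange α β (f * g) = affineChange α β f * affineChange α β g := mul_comp _ _ _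

theorem affineChange_add (α β : ℂ) (f g : ℂ[X]) :
    affineChange α β (f + g) = affineChange α β f + affineChange α β g := add_comp

theorem affineChange_sub (α β : ℂ) (f g : ℂ[X]) :
    affineChange α β (f - g) = affineChange α β f - affineChange α β g := sub_comp

theorem affineChange_C (α β c : ℂ) : affineChange α β (C c) = C c := C_comp

theorem isDividedDifference_normOp (q : ℝ) {α : ℂ} (hα : α ≠ 0) (β : ℂ) :
    IsDividedDifference (awAlpha q) (β * (1 - awAlpha q))
      (α ^ 2 * (awAlpha q ^ 2 - 1) + 2 * β ^ 2 * (1 - awAlpha q)) (normOp q α β) := by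
  have h := isDividedDifference_awOp q
  have hτ : ∀ f : ℂ[X], (X * f).comp (C α * X + C β) =
      C α * (X * f.comp (C α * X + C β)) + C β * f.comp (C α * X + C β) := fun f => by
    rw [mul_comp, X_comp]; ring
  refine ⟨?_, ?_, fun f => ?_⟩
  · rw [normOp_apply, awOpAffine, one_comp, h.map_one, affineChange, zero_comp, mul_zero]
  · rw [normOp_apply, awOpAffine, X_comp, map_add, map_C_mul, h.map_X, ← mul_one (C β), map_C_mul,
      h.map_one, mul_zero, add_zero, mul_one, affineChange_C, ← C_mul,
      inv_mul_cancel₀ hα, C_1]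
  · have hX := affineChange_X hα β
    have e0 : X ^ 2 * f = X * (X * f) := by ring
    simp only [normOp_apply, awOpAffine]
    rw [e0, hτ (X * f), hτ f]
    set g := f.comp (C α * X + C β)
    have e1 : X * (C α * (X * g) + C β * g) = C α * (X ^ 2 * g) + C β * (X * g) := by ring
    rw [e1]
    simp only [map_add, map_C_mul, h.rel g]
    have hX' : X = C α * affineChange α β X + C β := by rw [hX]; ring
    simp only [affineChange_add, affineChange_mul, affineChange_sub, affineChange_C, pow_two]
    generalize affineChange α β (awOp q (X * g)) = a
    generalize affineChange α β (awOp q g) = b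
    have two : affineChange α β 2 = 2 := affineChange_C α β 2
    rw [two]
    generalize affineChange α β X = Y at *
    rw [hX']
    simp only [C_0, C_sub, C_mul, C_1, map_ofNat]
    ring

theorem secondOrder_normOp (q : ℝ) {α : ℂ} (hα : α ≠ 0) (β a0 a1 a2 b0 b1 : ℂ) (g : ℂ[X]) :
    secondOrder (normOp q α β) (quad a0 a1 a2) (quad b0 b1 0) (affineChange α β g) =
      affineChange α β (secondOrder (awOp q)
        (quad ((a0 + a1 * β + a2 * β ^ 2 + β * (b0 + b1 * β)) / α ^ 2)
          ((a1 + 2 * a2 * β + β * b1) / α) a2)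
        (quad ((b0 + b1 * β) / α) b1 0) g) := by
  have hX' : X = C α * affineChange α β X + C β := by rw [affineChange_X hα]; ring
  have hN : ∀ f, normOp q α β (affineChange α β f) = C α⁻¹ * affineChange α β (awOp q f) :=
    fun f => by rw [normOp_apply, awOpAffine, affineChange_comp hα]
  have hXN : ∀ f, X * affineChange α β f = affineChange α β (C α * (X * f) + C β * f) :=
    fun f => by
      rw [affineChange_add, affineChange_mul, affineChange_mul, affineChange_mul, affineChange_C,
        affineChange_C]
      nth_rewrite 1 [hX']
      ring
  simp only [secondOrder_apply]
  rw [hN, mul_left_comm X, map_C_mul, hXN, map_C_mul, hN, hN, map_add, map_C_mul, map_C_mul]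
  simp only [quad, affineChange_add, affineChange_mul, affineChange_C, pow_two]
  generalize affineChange α β (awOp q (awOp q g)) = a
  generalize affineChange α β (awOp q (X * awOp q g)) = b
  generalize affineChange α β X = Y at *
  rw [hX']
  have hi : C α⁻¹ * C α = (1 : ℂ[X]) := by rw [← C_mul, inv_mul_cancel₀ hα, C_1]
  simp only [div_eq_mul_inv, mul_inv, C_0, C_mul, C_add, map_ofNat]
  linear_combination (a * (C α⁻¹ * Y * (C a1 + 2 * C a2 * C β + C b1 * C β)
    + C a2 * Y ^ 2 * (C α⁻¹ * C α + 1)) + b * (C α⁻¹ * (C b0 + C b1 * C β)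
    + C b1 * Y * (C α⁻¹ * C α + 1))) * hi

theorem natDegree_affineChange {α : ℂ} (hα : α ≠ 0) (β : ℂ) (f : ℂ[X]) :
    (affineChange α β f).natDegree = f.natDegree := by
  rw [affineChange, natDegree_comp, natDegree_C_mul (inv_ne_zero hα), natDegree_X_sub_C, mul_one]

theorem natDegree_eq_of_coeff_ne_zero {f : ℂ[X]} {n : ℕ} (hf : f ∈ degreeLT ℂ (n + 1))
    (hc : f.coeff n ≠ 0) : f.natDegree = n := by
  refine le_antisymm ?_ (le_natDegree_of_ne_zero hc)
  rw [natDegree_le_iff_coeff_eq_zero]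
  exact fun i hi => coeff_of_mem_degreeLT hf hi

theorem coeff_affineChange_ne_zero {α : ℂ} (hα : α ≠ 0) (β : ℂ) {f : ℂ[X]} {n : ℕ}
    (hf : f ∈ degreeLT ℂ (n + 1)) (hc : f.coeff n ≠ 0) :
    affineChange α β f ∈ degreeLT ℂ (n + 1) ∧ (affineChange α β f).coeff n ≠ 0 := by
  have h1 := natDegree_eq_of_coeff_ne_zero hf hc
  have h2 := natDegree_affineChange hα β f
  have h0 : affineChange α β f ≠ 0 := by
    intro h
    have := affineChange_comp hα β f
    rw [h, zero_comp] at this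
    rw [← this] at hc
    simp at hc
  have h3 := mem_degreeLT_natDegree (affineChange α β f)
  rw [h2, h1] at h3
  refine ⟨h3, ?_⟩
  rw [← h1, ← h2, coeff_natDegree]
  exact leadingCoeff_ne_zero.mpr h0

theorem qNumber_awAlpha {q : ℝ} (hq : 0 < q) (n : ℕ) :
    qNumber (awAlpha q) n * ((Real.sqrt q : ℂ) ^ 2 - 1) * (Real.sqrt q : ℂ) ^ n =
      ((Real.sqrt q : ℂ) ^ (2 * n) - 1) * Real.sqrt q := by
  have hs : (Real.sqrt q : ℂ) ≠ 0 := by exact_mod_cast (Real.sqrt_pos.mpr hq).ne'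
  have hα : awAlpha q = ((Real.sqrt q : ℂ) + (Real.sqrt q : ℂ)⁻¹) / 2 := by simp [awAlpha]
  rw [hα]
  generalize (Real.sqrt q : ℂ) = s at *
  induction n using Nat.twoStepInduction with
  | zero => simp [qNumber]
  | one => simp [qNumber]
  | more n h1 h2 =>
    have e : qNumber ((s + s⁻¹) / 2) (n + 2) =
      (s + s⁻¹) * qNumber ((s + s⁻¹) / 2) (n + 1) - qNumber ((s + s⁻¹) / 2) n := by
      rw [qNumber]; ring
    rw [e]
    have hi : s⁻¹ * s = 1 := inv_mul_cancel₀ hs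
    have e2 : ((s + s⁻¹) * qNumber ((s + s⁻¹) / 2) (n + 1) - qNumber ((s + s⁻¹) / 2) n) *
      (s ^ 2 - 1) * s ^ (n + 2) =
      (s + s⁻¹) * s * (qNumber ((s + s⁻¹) / 2) (n + 1) * (s ^ 2 - 1) * s ^ (n + 1))
        - s ^ 2 * (qNumber ((s + s⁻¹) / 2) n * (s ^ 2 - 1) * s ^ n) := by ring
    rw [e2, h1, h2]
    linear_combination (s ^ (2 * (n + 1)) - 1) * s * hi

/-- With `e = abcd`, an Askey-Wilson polynomial can drop in degree only where an eigenvalue factor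
vanishes. -/
theorem eigenFactor_eq_zero_of_mul_pow {q : ℝ} (hq : 0 < q) (hq1 : q < 1) {e a b : ℂ} {n : ℕ}
    (he : e * (a * Real.sqrt q + b) = (a + b * Real.sqrt q) * Real.sqrt q)
    (h : e * (q : ℂ) ^ (n + 1) = q) : eigenFactor (awAlpha q) a b (n + 1) = 0 := by
  obtain ⟨hs, hs2, h1q⟩ := sqrt_facts hq hq1
  have h1 := qNumber_awAlpha hq n
  have h2 := qNumber_awAlpha hq (n + 1)
  rw [← hs2] at h h1q
  rw [eigenFactor, Nat.add_sub_cancel]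
  generalize (Real.sqrt q : ℂ) = s at *
  have h3 : s ^ 2 - 1 ≠ 0 := by intro h; apply h1q; linear_combination -h
  have h4 : (s ^ 2 - 1) * s ^ (n + 1) ≠ 0 := mul_ne_zero h3 (pow_ne_zero _ hs)
  refine (mul_eq_zero.mp ?_).resolve_right h4
  have h5 : e * s ^ (2 * n) = 1 := by
    have : s ^ 2 * (e * s ^ (2 * n)) = s ^ 2 * 1 := by
      rw [mul_one]
      calc s ^ 2 * (e * s ^ (2 * n)) = e * (s ^ 2) ^ (n + 1) := by ring
        _ = s ^ 2 := h
    exact mul_left_cancel₀ (pow_ne_zero 2 hs) this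
  have e1 : (a * qNumber (awAlpha q) n + b * qNumber (awAlpha q) (n + 1)) *
      ((s ^ 2 - 1) * s ^ (n + 1)) =
      a * s * (qNumber (awAlpha q) n * (s ^ 2 - 1) * s ^ n) +
        b * (qNumber (awAlpha q) (n + 1) * (s ^ 2 - 1) * s ^ (n + 1)) := by ring
  rw [e1, h1, h2]
  linear_combination -s * s ^ (2 * n) * he + s * (a * s + b) * h5

/-! ### Passage to the limit and the theorem. -/

/-- The eigenfunctions of a limit of second order operators are limits of Askey-Wilson
polynomials. -/
theorem isAskeyWilsonLimitAlong_of_secondOrder {q : ℕ → ℝ} {α β : ℕ → ℂ} {A : ℂ}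
    {D : Module.End ℂ ℂ[X]} {p : ℕ → ℂ[X]} (hq : ∀ j, 0 < q j ∧ q j < 1) (hα : ∀ j, α j ≠ 0)
    (hD : ∀ f, CoeffTendsto (fun j => normOp (q j) (α j) (β j) f) (D f))
    (hA : Tendsto (fun j => awAlpha (q j)) atTop (𝓝 A))
    (hγ : ∀ n, qNumber A (n + 1) ≠ 0)
    (a0 a1 a2 b0 b1 : ℂ)
    (hT : IsTriangular (secondOrder D (quad a0 a1 a2) (quad b0 b1 0)) (eigenValue A a2 b1))
    (hp : ∀ n, secondOrder D (quad a0 a1 a2) (quad b0 b1 0) (p n) = C (eigenValue A a2 b1 n) * p n)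
    (hpd : ∀ n, p n ∈ degreeLT ℂ (n + 1)) (hpc : ∀ n, (p n).coeff n ≠ 0)
    (hθ : ∀ n, eigenFactor A a2 b1 (n + 1) ≠ 0) : IsAskeyWilsonLimitAlong q α β p := by
  -- perturb `a2` to make the Askey-Wilson parameters exist
  have hpert : ∀ j : ℕ, ∃ t : ℂ, dist a2 t < 1 / ((j : ℝ) + 1) ∧
      t * Real.sqrt (q j) + b1 ≠ 0 ∧ t + b1 * Real.sqrt (q j) ≠ 0 := by
    intro j
    have hs := (sqrt_facts (hq j).1 (hq j).2).1
    have hfin : ({-b1 / Real.sqrt (q j), -(b1 * Real.sqrt (q j))} : Set ℂ).Countable :=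
      (Set.toFinite _).countable
    obtain ⟨t, ht, hd⟩ := (hfin.dense_compl ℂ).exists_dist_lt a2
      (by positivity : (0 : ℝ) < 1 / ((j : ℝ) + 1))
    refine ⟨t, hd, fun h => ht (Or.inl ?_), fun h => ht (Or.inr ?_)⟩
    · rw [eq_div_iff hs]; linear_combination h
    · rw [Set.mem_singleton_iff]; linear_combination h
  choose t htd ht1 ht2 using hpert
  have htl : Tendsto t atTop (𝓝 a2) := by
    rw [tendsto_iff_dist_tendsto_zero]
    refine squeeze_zero (fun _ => dist_nonneg) (fun j => ?_)
      (tendsto_one_div_add_atTop_nhds_zero_nat (𝕜 := ℝ))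
    rw [dist_comm]; exact (htd j).le
  choose κ a b c d ha habcd hN using fun j => exists_parameters (hq j).1
    ((a0 + a1 * β j + t j * β j ^ 2 + β j * (b0 + b1 * β j)) / α j ^ 2)
    ((a1 + 2 * t j * β j + β j * b1) / α j) (t j) ((b0 + b1 * β j) / α j) b1 (ht1 j) (ht2 j)
  have hdd := fun j => isDividedDifference_normOp (q j) (hα j) (β j)
  set N := fun j => normOp (q j) (α j) (β j) with hNdef
  set L := fun j => secondOrder (N j) (quad a0 a1 (t j)) (quad b0 b1 0) with hLdef
  set M := secondOrder D (quad a0 a1 a2) (quad b0 b1 0)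
  set F : ℕ → ℕ → ℂ[X] := fun n j =>
    affineChange (α j) (β j) (awPoly (q j) (a j) (b j) (c j) (d j) n) with hF
  have hLT : ∀ j, IsTriangular (L j) (eigenValue (awAlpha (q j)) (t j) b1) := fun j =>
    (hdd j).isTriangular a0 a1 (t j) b0 b1
  have hLF : ∀ n j, ∃ μ, L j (F n j) = C μ * F n j := by
    intro n j
    obtain ⟨μ, hμ⟩ := secondOrder_awPoly (hq j).1 (hq j).2 (hN j) n
    refine ⟨μ, ?_⟩
    simp only [hLdef, hNdef, hF]
    rw [secondOrder_normOp _ (hα j), hμ, affineChange_mul, affineChange_C]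
  have hLM : ∀ f, CoeffTendsto (fun j => L j f) (M f) := by
    intro f
    have hf := mem_degreeLT_natDegree f
    have h1 : ∀ j, N j f ∈ degreeLT ℂ f.natDegree := fun j => (hdd j).map_degreeLT _ _ hf
    have hXm : (X : ℂ[X]) ∈ degreeLT ℂ (1 + 1) := by simpa using X_pow_mem_degreeLT 1
    have t1 := CoeffTendsto.map hD (hD f) h1
    have t2 := CoeffTendsto.map hD ((CoeffTendsto.const X).mul (hD f))
      fun j => mul_mem_degreeLT hXm (h1 j)
    exact ((CoeffTendsto.quad tendsto_const_nhds tendsto_const_nhds htl).mul t1).add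
      ((CoeffTendsto.const _).mul t2)
  have hθl : ∀ n, Tendsto (fun j => eigenFactor (awAlpha (q j)) (t j) b1 n) atTop
      (𝓝 (eigenFactor A a2 b1 n)) := fun n =>
    (htl.mul (tendsto_qNumber hA _)).add ((tendsto_qNumber hA _).const_mul b1)
  have hlam : ∀ n, Tendsto (fun j => eigenValue (awAlpha (q j)) (t j) b1 n) atTop
      (𝓝 (eigenValue A a2 b1 n)) := fun n => (tendsto_qNumber hA _).mul (hθl n)
  set Λ : ℕ → ℕ → ℂ := fun n j => ∏ m ∈ Finset.range n, (eigenValue (awAlpha (q j)) (t j) b1 n -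
    eigenValue (awAlpha (q j)) (t j) b1 m) with hΛ
  set Λ' : ℕ → ℂ := fun n => ∏ m ∈ Finset.range n, (eigenValue A a2 b1 n -
    eigenValue A a2 b1 m) with hΛ'
  have hΛl : ∀ n, Tendsto (Λ n) atTop (𝓝 (Λ' n)) := fun n =>
    tendsto_finsetProd _ fun m _ => (hlam n).sub (hlam m)
  have hΛ0 : ∀ n, Λ' n ≠ 0 := by
    intro n
    refine Finset.prod_ne_zero_iff.mpr fun m hm => ?_
    obtain ⟨i, rfl⟩ : ∃ i, n = m + i + 1 := ⟨n - m - 1, by have := Finset.mem_range.mp hm; omega⟩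
    rw [eigenValue_sub]
    exact mul_ne_zero (hγ i) (by rw [show m + (m + i + 1) = m + (m + i) + 1 by ring]; exact hθ _)
  -- The limiting factors are nonzero, so for large `j` the perturbed ones are too, and the
  -- Askey-Wilson polynomial has exact degree `n`.
  have hFc : ∀ n, ∀ᶠ j in atTop, F n j ∈ degreeLT ℂ (n + 1) ∧ (F n j).coeff n ≠ 0 := by
    intro n
    have : ∀ᶠ j in atTop, ∀ i ∈ Finset.range n,
        eigenFactor (awAlpha (q j)) (t j) b1 (n + i) ≠ 0 := by
      rw [Finset.eventually_all]
      intro i hi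
      obtain ⟨m, hm⟩ : ∃ m, n + i = m + 1 :=
        ⟨n + i - 1, by have := Finset.mem_range.mp hi; omega⟩
      rw [hm]
      exact (hθl (m + 1)).eventually_ne (hθ m)
    filter_upwards [this] with j hj
    refine coeff_affineChange_ne_zero (hα j) (β j) (awPoly_mem_degreeLT _ _ _ _ _ n)
      (coeff_awPoly_ne_zero (hq j).1 (hq j).2 (ha j) fun i hi h => ?_)
    refine hj i (Finset.mem_range.mpr hi) ?_
    obtain ⟨m, hm⟩ : ∃ m, n + i = m + 1 := ⟨n + i - 1, by omega⟩
    rw [hm] at h ⊢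
    exact eigenFactor_eq_zero_of_mul_pow (hq j).1 (hq j).2 (habcd j) h
  -- The ratio of the two normalisations in `eigen_eq`. It can vanish when eigenvalues collide or
  -- the degree drops, which does not happen for large `j` at fixed `n`; there the value 1 replaces
  -- it.
  let r : ℕ → ℕ → ℂ := fun n j => (p n).coeff n / Λ' n * (Λ n j / (F n j).coeff n)
  refine ⟨a, b, c, d, ha, fun n j => if r n j = 0 then 1 else r n j, fun n j => ?_, fun n => ?_⟩
  · dsimp only
    split_ifs with h
    · exact one_ne_zero
    · exact h
  have hlim := eigenProd_tendsto hLM hLT hlam n (n + 1) (CoeffTendsto.const (X ^ n))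
    fun _ => X_pow_mem_degreeLT n
  have hpn : p n = C ((p n).coeff n / Λ' n) *
      eigenProd M (eigenValue A a2 b1) n (X ^ n) := by
    have := hT.eigen_eq (hpd n) (hp n) (hpc n)
    rw [div_eq_inv_mul, C_mul, mul_assoc, ← this, ← mul_assoc, ← C_mul,
      inv_mul_cancel₀ (hΛ0 n), C_1, one_mul]
  rw [hpn]
  refine CoeffTendsto.congr' ((CoeffTendsto.const _).mul hlim) ?_
  filter_upwards [hFc n, (hΛl n).eventually_ne (hΛ0 n)] with j hj hj0
  obtain ⟨μ, hμ⟩ := hLF n j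
  have := (hLT j).eigen_eq hj.1 hμ hj.2
  have hr : r n j ≠ 0 := mul_ne_zero (div_ne_zero (hpc n) (hΛ0 n)) (div_ne_zero hj0 hj.2)
  rw [if_neg hr]
  simp only [r]
  rw [C_mul, mul_assoc, div_eq_inv_mul (Λ n j), C_mul, mul_assoc]
  rw [this, ← mul_assoc (C _⁻¹), ← C_mul, inv_mul_cancel₀ hj.2, C_1, one_mul]

/-- `α_j` and `β_j` need not converge, but the three conic parameters do: they can be read off from
the images of `X²` and `X³`. -/
theorem exists_tendsto_of_normOp {q : ℕ → ℝ} {α β : ℕ → ℂ} {D : Module.End ℂ ℂ[X]}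
    (hq : ∀ j, 0 < q j ∧ q j < 1) (hα : ∀ j, α j ≠ 0)
    (hD : ∀ f, CoeffTendsto (fun j => normOp (q j) (α j) (β j) f) (D f)) :
    ∃ (r : ℝ) (δ ε : ℂ), 1 ≤ r ∧ Tendsto (fun j => awAlpha (q j)) atTop (𝓝 (r : ℂ)) ∧
      IsDividedDifference r δ ε D := by
  have hdd := fun j => isDividedDifference_normOp (q j) (hα j) (β j)
  set N := fun j => normOp (q j) (α j) (β j) with hNdef
  set δ := fun j => β j * (1 - awAlpha (q j)) with hδ
  set ε := fun j => α j ^ 2 * (awAlpha (q j) ^ 2 - 1) + 2 * β j ^ 2 * (1 - awAlpha (q j)) with hε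
  have hN2 : ∀ j, N j (X ^ 2) = C (2 * δ j) + C (2 * awAlpha (q j)) * X := by
    intro j
    have := (hdd j).rel 1
    simp only [mul_one, (hdd j).map_one, (hdd j).map_X, mul_zero, sub_zero] at this
    simp only [C_mul, map_ofNat]
    rw [this]
    ring
  have hN3 : ∀ j, (N j (X ^ 2 * X)).coeff 0 = 2 * δ j * (2 * δ j) - ε j := by
    intro j
    rw [(hdd j).rel X, (hdd j).map_X, ← pow_two, hN2, coeff_zero_eq_eval_zero]
    simp [hδ, hε]
  have l1 : Tendsto (fun j => awAlpha (q j)) atTop (𝓝 ((D (X ^ 2)).coeff 1 / 2)) := by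
    have := (hD (X ^ 2) 1).div_const 2
    refine this.congr fun j => ?_
    change (N j (X ^ 2)).coeff 1 / 2 = _
    rw [hN2]
    simp [coeff_C]
  have l2 : Tendsto δ atTop (𝓝 ((D (X ^ 2)).coeff 0 / 2)) := by
    have := (hD (X ^ 2) 0).div_const 2
    refine this.congr fun j => ?_
    change (N j (X ^ 2)).coeff 0 / 2 = _
    rw [hN2]
    simp
  obtain ⟨δ', hδ'⟩ : ∃ δ', Tendsto δ atTop (𝓝 δ') := ⟨_, l2⟩
  have l3 : Tendsto ε atTop (𝓝 (2 * δ' * (2 * δ') - (D (X ^ 2 * X)).coeff 0)) := by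
    have := ((hδ'.const_mul 2).mul (hδ'.const_mul 2)).sub (hD (X ^ 2 * X) 0)
    refine this.congr fun j => ?_
    change _ - (N j (X ^ 2 * X)).coeff 0 = _
    rw [hN3]
    ring
  obtain ⟨ε', hε'⟩ : ∃ ε', Tendsto ε atTop (𝓝 ε') := ⟨_, l3⟩
  -- Each `awAlpha` is real and at least 1 by the arithmetic-geometric mean inequality, a closed
  -- condition; it keeps the limiting `q`-numbers nonzero.
  obtain ⟨r, hr, hrA⟩ : ∃ r : ℝ, 1 ≤ r ∧ (r : ℂ) = (D (X ^ 2)).coeff 1 / 2 := by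
    have hcl : IsClosed ((fun x : ℝ => (x : ℂ)) '' Set.Ici 1) :=
      Complex.isometry_ofReal.isClosedEmbedding.isClosedMap _ isClosed_Ici
    obtain ⟨r, hr, h⟩ := hcl.mem_of_tendsto l1 (Eventually.of_forall fun j => by
      refine ⟨(Real.sqrt (q j) + (Real.sqrt (q j))⁻¹) / 2, ?_, rfl⟩
      have hs := Real.sqrt_pos.mpr (hq j).1
      have h1 : Real.sqrt (q j) * (Real.sqrt (q j))⁻¹ = 1 := mul_inv_cancel₀ hs.ne'
      have h2 : 0 < (Real.sqrt (q j))⁻¹ := inv_pos.mpr hs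
      rw [Set.mem_Ici]
      nlinarith [sq_nonneg (Real.sqrt (q j) - (Real.sqrt (q j))⁻¹)])
    exact ⟨r, hr, h⟩
  rw [← hrA] at l1
  refine ⟨r, δ', ε', hr, l1, ?_, ?_, fun f => ?_⟩
  · refine CoeffTendsto.unique (hD 1) ?_
    simp only [fun j => (hdd j).map_one]
    exact CoeffTendsto.const 0
  · refine CoeffTendsto.unique (hD X) ?_
    simp only [fun j => (hdd j).map_X]
    exact CoeffTendsto.const 1
  · refine CoeffTendsto.unique (hD _) ?_
    simp only [fun j => (hdd j).rel f]
    have t1 := CoeffTendsto.C l1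
    have t2 := CoeffTendsto.C hδ'
    have t3 := CoeffTendsto.C hε'
    have k := CoeffTendsto.const (2 : ℂ[X])
    have x := CoeffTendsto.const (X : ℂ[X])
    exact ((((k.mul t1).mul x).add (k.mul t2)).mul (hD _)).sub
      ((((CoeffTendsto.const (X ^ 2)).sub ((k.mul t2).mul x)).add t3).mul (hD _))

theorem isAskeyWilsonLimitAlong_of_limiting {p : ℕ → ℂ[X]} (hp : IsOPS p) (k : ℕ) {q : ℕ → ℝ}
    {α β : ℕ → ℂ} {D : Module.End ℂ ℂ[X]} (hD : IsLimitingAWOp q α β D)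
    (hQ : IsOPS (fun n => (D ^ (k + 1)) (p (n + (k + 1))))) :
    IsAskeyWilsonLimitAlong q α β p := by
  obtain ⟨hq, hα, κ, hκ⟩ := hD
  obtain ⟨hdeg, u, hu1, hu2⟩ := hp
  have hu : IsOrthogonalFor p u := ⟨hdeg, hu1, hu2⟩
  obtain ⟨hQdeg, v, hv1, hv2⟩ := hQ
  have hv : IsOrthogonalFor (fun n => (D ^ (k + 1)) (p (n + (k + 1)))) v := ⟨hQdeg, hv1, hv2⟩
  have hdd := fun j => isDividedDifference_normOp (q j) (hα j) (β j)
  have hN : ∀ f, CoeffTendsto (fun j => C (κ j * α j) * normOp (q j) (α j) (β j) f) (D f) := by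
    intro f
    refine (hκ f).congr' (Eventually.of_forall fun j => ?_)
    rw [normOp_apply, ← mul_assoc, ← C_mul, mul_assoc, mul_inv_cancel₀ (hα j), mul_one]
  have hD1 : D 1 = 0 := by
    refine CoeffTendsto.unique (hN 1) ?_
    simp only [fun j => (hdd j).map_one, mul_zero]
    exact CoeffTendsto.const 0
  have hν : Tendsto (fun j => κ j * α j) atTop (𝓝 ((D X).coeff 0)) := by
    refine (hN X 0).congr fun j => ?_
    dsimp only
    rw [(hdd j).map_X, mul_one, coeff_C_zero]
  have hDX : D X = C ((D X).coeff 0) := by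
    refine CoeffTendsto.unique (hN X) ?_
    simp only [fun j => (hdd j).map_X, mul_one]
    exact CoeffTendsto.C hν
  have hDd : ∀ n, ∀ f ∈ degreeLT ℂ (n + 1), D f ∈ degreeLT ℂ n := fun n f hf =>
    (hN f).mem_degreeLT fun j => C_mul_mem_degreeLT _ ((hdd j).map_degreeLT n f hf)
  have hDk : ∀ m n, ∀ f ∈ degreeLT ℂ (n + m), (D ^ m) f ∈ degreeLT ℂ n := by
    intro m
    induction m with
    | zero => exact fun n f hf => hf
    | succ m ih =>
      intro n f hf
      rw [pow_succ]
      exact ih n _ (hDd _ _ hf)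
  obtain ⟨ν, hνdef⟩ : ∃ ν, ν = (D X).coeff 0 := ⟨_, rfl⟩
  rw [← hνdef] at hν hDX
  -- If `D X = 0`, then `D` kills all polynomials of degree at most one, in particular `(D ^ k) (p
  -- (k + 1))`, so `Q 0 = 0`. Otherwise `D / ν` is the limit of the normalised operators.
  have hν0 : ν ≠ 0 := by
    rintro rfl
    have h1 := hDk k 2 (p (k + 1)) (by rw [add_comm]; exact hu.mem_degreeLT (k + 1))
    have h2 : ((D ^ k) (p (k + 1))) = C (((D ^ k) (p (k + 1))).coeff 0) * 1 +
        C (((D ^ k) (p (k + 1))).coeff 1) * X := by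
      have h3 := eq_C_of_mem_degreeLT_one (sub_leading_mem_degreeLT h1)
      rw [coeff_sub, pow_one, coeff_C_mul, coeff_X_zero, mul_zero, sub_zero] at h3
      linear_combination h3
    have h4 := hv.coeff_ne 0
    apply h4
    simp only [zero_add]
    rw [pow_succ']
    change (D ((D ^ k) (p (k + 1)))).coeff 0 = 0
    rw [h2, map_add, map_C_mul, map_C_mul, hD1, hDX]
    simp
  have hN' : ∀ f, CoeffTendsto (fun j => normOp (q j) (α j) (β j) f) ((ν⁻¹ • D) f) := by
    intro f
    rw [LinearMap.smul_apply, smul_eq_C_mul]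
    refine ((CoeffTendsto.C (hν.inv₀ hν0)).mul (hN f)).congr' ?_
    filter_upwards [hν.eventually_ne hν0] with j hj
    rw [← mul_assoc, ← C_mul, inv_mul_cancel₀ hj, C_1, one_mul]
  obtain ⟨r, δ, ε, hr, hA, hDD⟩ := exists_tendsto_of_normOp hq hα hN'
  have hc : (ν⁻¹ ^ (k + 1)) ≠ 0 := pow_ne_zero _ (inv_ne_zero hν0)
  have hv' : IsOrthogonalFor (fun n => ((ν⁻¹ • D) ^ (k + 1)) (p (n + (k + 1)))) v := by
    have e : ∀ n, ((ν⁻¹ • D) ^ (k + 1)) (p (n + (k + 1))) =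
        C (ν⁻¹ ^ (k + 1)) * (D ^ (k + 1)) (p (n + (k + 1))) := fun n => by
      rw [_root_.smul_pow, LinearMap.smul_apply, smul_eq_C_mul]
    have em : ∀ c f g, v (C c * f * (C c * g)) = c * (c * v (f * g)) := fun c f g => by
      rw [show C c * f * (C c * g) = C c * (C c * (f * g)) by ring, map_C_mul', map_C_mul']
    simp only [e]
    refine ⟨fun n => ?_, fun m n hmn => ?_, fun n => ?_⟩
    · rw [degree_C_mul hc]; exact hQdeg n
    · rw [em, hv1 m n hmn, mul_zero, mul_zero]
    · rw [em]; exact mul_ne_zero hc (mul_ne_zero hc (hv2 n))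
  obtain ⟨a0, a1, a2, b0, b1, hL, hθ⟩ := hDD.exists_secondOrder (qNumber_ne_zero hr) hu k hv'
  exact isAskeyWilsonLimitAlong_of_secondOrder hq hα hN' hA (qNumber_ne_zero hr) a0 a1 a2 b0 b1
    (hDD.isTriangular a0 a1 a2 b0 b1) hL hu.mem_degreeLT hu.coeff_ne hθ

theorem affineChange_one_zero (f : ℂ[X]) : affineChange 1 0 f = f := by
  simp [affineChange]

theorem mainTheorem2 (p : ℕ → ℂ[X]) (hp : IsOPS p) (k : ℕ) (hk : 1 ≤ k) :
    (∀ q : ℝ, 0 < q → q < 1 →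
      IsOPS (fun n => (awOp q ^ k) (p (n + k))) →
        IsAskeyWilsonOrLimit q p) ∧
    (∀ (q : ℕ → ℝ) (α β : ℕ → ℂ) (D : Module.End ℂ ℂ[X]), IsLimitingAWOp q α β D →
      IsOPS (fun n => (D ^ k) (p (n + k))) →
        IsAskeyWilsonLimitAlong q α β p) := by
  obtain ⟨k, rfl⟩ : ∃ m, k = m + 1 := ⟨k - 1, by omega⟩
  refine ⟨fun q hq hq1 hQ => ?_, fun q α β D hD hQ =>
    isAskeyWilsonLimitAlong_of_limiting hp k hD hQ⟩
  -- The first statement is the second for constant sequences and the identity change of variable.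
  have hD : IsLimitingAWOp (fun _ => q) (fun _ => 1) (fun _ => 0) (awOp q) := by
    refine ⟨fun _ => ⟨hq, hq1⟩, fun _ => one_ne_zero, fun _ => 1, fun f => ?_⟩
    have : ∀ f, awOpAffine q 1 0 f = awOp q f := fun f => by
      simp [awOpAffine, affineChange_one_zero]
    simp only [this, C_1, one_mul]
    exact CoeffTendsto.const _
  obtain ⟨a, b, c, d, ha, r, hr, h⟩ := isAskeyWilsonLimitAlong_of_limiting hp k hD hQ
  refine ⟨a, b, c, d, ha, r, hr, fun n => ?_⟩
  simpa only [affineChange_one_zero] using h n
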